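/- Call a pair $(c,y)$, with $c\ge 0$ and $y$ integers, \emph{$m$-effective} if there is a skew-symmetric matrix $A$ of size $2c+2$ whose entries are linear forms in three variables over $\mathbb C$, whose specialisations form a $3$-dimensional linear space of matrices in which every non-zero matrix has rank $2c$ (``constant rank $2c$''), and such that the cokernel $E$ of the induced map $A:\mathcal O_{\mathbb P^2}(-1)^{2c+2}\to\mathcal O_{\mathbb P^2}^{2c+2}$ (a vector bundle of rank $2$ on $\mathbb P^2$) has Chern classes $(c_1(E),c_2(E))=(c,y)$. If $(c,y)$ is $m$-effective, then $c>0$ and $$0\le y\le \binom{c+1}{2}.$$ Both bounds are sharp: for every integer $c>0$ the pairs $(c,0)$ and $\left(c,\binom{c+1}{2}\right)$ are $m$-effective. More precisely, for every $c>0$: (i) there is a matrix $A$ as above with cokernel $E\cong\mathcal O_{\mathbb P^2}\oplus\mathcal O_{\mathbb P^2}(c)$ and $(c_1(E),c_2(E))=(c,0)$; (ii) there exist Steiner bundles of rank $2$, that is, vector bundles $E$ on $\mathbb P^2$ with an exact sequence $0\to\mathcal O_{\mathbb P^2}(-1)^{c}\to\mathcal O_{\mathbb P^2}^{c+2}\to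 E\to 0$, and each of them is isomorphic to the cokernel of a matrix $A$ as above, with $(c_1(E),c_2(E))=\left(c,\binom{c+1}{2}\right)$. -/

import Mathlib

open MvPolynomial

namespace PlaneBundle

/-- The homogeneous coordinate ring `ℂ[x₀, x₁, x₂]` of the projective plane. The points of the plane
are the nonzero vectors `v : Fin 3 → ℂ` up to scaling. -/
abbrev Coord : Type := MvPolynomial (Fin 3) ℂ

/-- `p` is a form of degree `d`, that is, a global section of `𝒪(d)`. Only `0` is a form of negative
degree. -/
def IsForm (p : Coord) (d : ℤ) : Prop := ∀ m ∈ p.support, (m.degree : ℤ) = d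

theorem isForm_of_isHomogeneous {p : Coord} {k : ℕ} {d : ℤ} (h : p.IsHomogeneous k)
    (hd : (k : ℤ) = d) : IsForm p d := by
  intro m hm
  have h1 := h (mem_support_iff.mp hm)
  rw [Finsupp.weight_apply] at h1
  rw [← hd, ← h1, Finsupp.degree_eq_sum, Finsupp.sum_fintype _ _ (by simp)]
  simp

/-- The vector bundle `⨁ i, 𝒪(twist i)` on the projective plane. -/
structure SplitBundle where
  rank : ℕ
  twist : Fin rank → ℤ

/-- The bundle `𝒪(d)ⁿ`. -/
abbrev copies (n : ℕ) (d : ℤ) : SplitBundle := ⟨n, fun _ => d⟩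

/-- A morphism `⨁ j, 𝒪(a j) ⟶ ⨁ i, 𝒪(b i)`: a matrix whose `(i, j)` entry is a form of degree
`b i - a j`. -/
structure SplitBundle.Hom (F G : SplitBundle) where
  mat : Matrix (Fin G.rank) (Fin F.rank) Coord
  isForm : ∀ i j, IsForm (mat i j) (G.twist i - F.twist j)

/-- The linear map induced by a morphism on the fibres at the point `[v]` (in the trivialisation of
the fibres given by the choice of the representative `v`). -/
noncomputable def SplitBundle.Hom.fibre {F G : SplitBundle} (φ : F.Hom G) (v : Fin 3 → ℂ) :
    (Fin F.rank → ℂ) →ₗ[ℂ] (Fin G.rank → ℂ) :=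
  (φ.mat.map (eval v)).mulVecLin

/-- The fibre at `[v]` of the cokernel of `φ`. -/
abbrev SplitBundle.Hom.CokerFibre {F G : SplitBundle} (φ : F.Hom G) (v : Fin 3 → ℂ) : Type :=
  (Fin G.rank → ℂ) ⧸ LinearMap.range (φ.fibre v)

/-- The morphism from the zero bundle to `F`; its cokernel is `F`. -/
def SplitBundle.fromZero (F : SplitBundle) : (copies 0 0).Hom F where
  mat := fun _ j => Fin.elim0 j
  isForm := fun _ j => Fin.elim0 j

/-- A matrix of linear forms as a morphism `𝒪(-1)ⁿ ⟶ 𝒪ᵐ`. -/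
def linearHom {m n : ℕ} (A : Matrix (Fin m) (Fin n) Coord)
    (hA : ∀ i j, (A i j).IsHomogeneous 1) : (copies n (-1)).Hom (copies m 0) where
  mat := A
  isForm := fun i j => isForm_of_isHomogeneous (hA i j) (by simp)

/-- A finite resolution
`0 ⟶ L length ⟶ ⋯ ⟶ L 1 ⟶ L 0 ⟶ E ⟶ 0` of the vector bundle `E = coker φ` by sums of line bundles,
where the last map is the composition of a morphism `aug : L 0 ⟶ G` with the projection `G ⟶ E`.
A complex of vector bundles is exact if and only if it is exact on the fibres at every point. -/
structure Resolution {F G : SplitBundle} (φ : F.Hom G) where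
  length : ℕ
  L : ℕ → SplitBundle
  rank_eq_zero : ∀ i, length < i → (L i).rank = 0
  d : ∀ i, (L (i + 1)).Hom (L i)
  aug : (L 0).Hom G
  exact : ∀ v : Fin 3 → ℂ, v ≠ 0 → ∀ i, Function.Exact ((d (i + 1)).fibre v) ((d i).fibre v)
  exact_aug : ∀ v : Fin 3 → ℂ, v ≠ 0 →
    Function.Exact ((d 0).fibre v) ((LinearMap.range (φ.fibre v)).mkQ ∘ₗ aug.fibre v)
  surjective_aug : ∀ v : Fin 3 → ℂ, v ≠ 0 →
    Function.Surjective ((LinearMap.range (φ.fibre v)).mkQ ∘ₗ aug.fibre v)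

/-- The Chow ring `ℤ[h]/(h³)` of the projective plane. -/
def Chow : Type := AdjoinRoot (Polynomial.X ^ 3 : Polynomial ℤ)

noncomputable instance : CommRing Chow :=
  inferInstanceAs (CommRing (AdjoinRoot (Polynomial.X ^ 3 : Polynomial ℤ)))

/-- The class of a line. -/
noncomputable def lineClass : Chow := AdjoinRoot.root (Polynomial.X ^ 3 : Polynomial ℤ)

/-- The total Chern class of `⨁ i, 𝒪(a i)`, namely `∏ i, (1 + a i h)`. -/
noncomputable def SplitBundle.totalChern (F : SplitBundle) : Chow :=
  ∏ i, (1 + (F.twist i : Chow) * lineClass)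

/-- The vector bundle `E = coker φ` has Chern classes `c₁(E) = a h` and `c₂(E) = b h²`.
By the Whitney formula the total Chern class `c(E) = 1 + c₁(E) + c₂(E)` is the alternating product of
the total Chern classes of the terms of a resolution; it does not depend on the resolution, and a
resolution exists for every `φ` of constant rank. -/
def HasChernClasses {F G : SplitBundle} (φ : F.Hom G) (a b : ℤ) : Prop :=
  ∃ R : Resolution φ,
    (1 + (a : Chow) * lineClass + (b : Chow) * lineClass ^ 2) *
        ∏ i ∈ (Finset.range (R.length + 1)).filter (fun i => Odd i), (R.L i).totalChern =
      ∏ i ∈ (Finset.range (R.length + 1)).filter (fun i => Even i), (R.L i).totalChern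

/-- The cokernels of `φ : F₁ ⟶ F₀` and `ψ : G₁ ⟶ G₀` are isomorphic vector bundles, by an isomorphism
induced by a morphism `π : F₀ ⟶ G₀`. -/
def CokerIso {F₁ F₀ G₁ G₀ : SplitBundle} (φ : F₁.Hom F₀) (ψ : G₁.Hom G₀) : Prop :=
  ∃ π : F₀.Hom G₀, ∀ v : Fin 3 → ℂ, v ≠ 0 →
    ∃ h : LinearMap.range (φ.fibre v) ≤ (LinearMap.range (ψ.fibre v)).comap (π.fibre v),
      Function.Bijective
        (Submodule.mapQ _ _ (π.fibre v) h : φ.CokerFibre v →ₗ[ℂ] ψ.CokerFibre v)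

/-- `A` is a skew-symmetric matrix of linear forms in three variables of size `2c + 2` and constant
rank `2c`, whose specialisations form a linear space of matrices of dimension three. -/
structure IsSkewConstantRank (c : ℕ)
    (A : Matrix (Fin (2 * c + 2)) (Fin (2 * c + 2)) Coord) : Prop where
  linear : ∀ i j, (A i j).IsHomogeneous 1
  skew : A.transpose = -A
  dim_three : Function.Injective fun v : Fin 3 → ℂ => A.map (eval v)
  constant_rank : ∀ v : Fin 3 → ℂ, A.map (eval v) ≠ 0 → (A.map (eval v)).rank = 2 * c

/-- The pair `(c, y)` is `m`-effective. -/
def MEffective (c : ℕ) (y : ℤ) : Prop :=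
  ∃ (A : Matrix (Fin (2 * c + 2)) (Fin (2 * c + 2)) Coord) (hA : IsSkewConstantRank c A),
    HasChernClasses (linearHom A hA.linear) c y

/-- `B` is a matrix of linear forms that defines a Steiner bundle of rank two, that is, a vector
bundle `E` with an exact sequence `0 ⟶ 𝒪(-1)ᶜ ⟶ 𝒪ᶜ⁺² ⟶ E ⟶ 0`. -/
structure IsSteiner (c : ℕ) (B : Matrix (Fin (c + 2)) (Fin c) Coord) : Prop where
  linear : ∀ i j, (B i j).IsHomogeneous 1
  injective : ∀ v : Fin 3 → ℂ, v ≠ 0 → Function.Injective ((linearHom B linear).fibre v)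

end PlaneBundle

/-! Let I and K be the image and the kernel of A : 𝒪(-1)ⁿ ⟶ 𝒪ⁿ, n = 2c + 2. Then `rangeSec A t` is
H⁰(I(t)) and `kerSec A t` is H⁰(K(t + 1)). For large t the Hilbert polynomial of E gives the
dimensions of both, with y entering I(t) with sign plus and K(t + 1) with sign minus. So each bound
on y follows from an upper bound, for large t, on the dimension of one of these spaces.

Upper bound on y. By skew-symmetry, (Aa, Ab) ↦ a · Ab is a well-defined nondegenerate alternating
form on I with values in 𝒪(-1). As 𝒪(-1) has no nonzero section, the constant sections of I span an
isotropic subspace of a fibre of dimension 2c, whence h⁰(I) ≤ c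
(`IsSkewPencil.two_mul_finrank_rangeSec_zero_le`). This holds on a line as well as on the plane.
Restriction to a point of a line gives h⁰ ≤ c + 2ct on the line, and restriction to a line gives
h⁰(I(t)) ≤ c(t + 1)² on the plane.

Lower bound on y. On a line, K(1) ought to be 𝒪(-p) ⊕ 𝒪(-q) with p, q ≥ 0 and p + q = c, so that h⁰
≤ max(t + 1, 2t + 2 - c). The splitting theorem is not needed: if u₁, u₂ are independent sections of
the kernel of degrees a, b, the constant vectors w with u₁ · w = u₂ · w = 0 are sections of I, so 2c
+ 2 ≤ (a + 1) + (b + 1) + c and a + b ≥ c (`IsSkewPencil.le_add_of_minor_ne_zero`). Counting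
dimensions degree by degree gives the bound on the line, and summing over degrees gives it on the
plane.

Passage to Chern classes. A section of high degree lying pointwise in the image of a constant-rank
matrix lifts (`exists_forall_exists_mulVec_eq`, a form of Serre vanishing), so resolutions are exact
on sections in high degree. The Whitney formula becomes additive in the rank and in the first two
power sums of the Chern roots, which are exactly the data of the Hilbert polynomial
(`HasChernClasses.hilbertPolynomial`).

Sharpness. A Steiner matrix B gives the skew matrix with off-diagonal blocks Bᵀ and -B, whose
cokernel is that of B. The cokernel 𝒪 ⊕ 𝒪(c) comes from a matrix of size 2c + 1 supported on three
antidiagonals, enlarged by a zero row and column. -/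

namespace PlaneBundle

/-! ### Matrices of constant rank -/

section ConstantRank

variable {σ ι κ : Type*} [Fintype κ]

/-- The value of a vector of polynomials at a point. -/
noncomputable def evalVec (v : σ → ℂ) : (ι → MvPolynomial σ ℂ) →ₗ[ℂ] (ι → ℂ) where
  toFun s i := eval v (s i)
  map_add' _ _ := by ext; simp
  map_smul' _ _ := by ext; simp

@[simp] theorem evalVec_apply (v : σ → ℂ) (s : ι → MvPolynomial σ ℂ) (i : ι) :
    evalVec v s i = eval v (s i) := rfl

theorem evalVec_mulVec (v : σ → ℂ) (φ : Matrix ι κ (MvPolynomial σ ℂ))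
    (u : κ → MvPolynomial σ ℂ) :
    evalVec v (φ.mulVec u) = (φ.map (eval v)).mulVec (evalVec v u) := by
  ext i
  simp [Matrix.mulVec, dotProduct]

theorem evalVec_smul (v : σ → ℂ) (p : MvPolynomial σ ℂ) (s : ι → MvPolynomial σ ℂ) :
    evalVec v (p • s) = eval v p • evalVec v s := by
  ext i
  simp

theorem ext_of_evalVec {s t : ι → MvPolynomial σ ℂ} (p : MvPolynomial σ ℂ) (hp : p ≠ 0)
    (h : ∀ v, eval v p ≠ 0 → evalVec v s = evalVec v t) : s = t := by
  ext1 i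
  have h1 : p * s i = p * t i := by
    refine MvPolynomial.funext fun v => ?_
    by_cases hv : eval v p = 0
    · simp [hv]
    · have := congrFun (h v hv) i
      simp only [evalVec_apply] at this
      simp [this]
  exact mul_left_cancel₀ hp h1

/-- Pointwise membership of a vector in the column space of a matrix. -/
def InRange (φ : Matrix ι κ (MvPolynomial σ ℂ)) (s : ι → MvPolynomial σ ℂ) (v : σ → ℂ) : Prop :=
  evalVec v s ∈ LinearMap.range (φ.map (eval v)).mulVecLin

variable [Fintype ι]

/-- `Q` lifts a basis of the column space and `P` is a retraction onto that basis. The product plays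
the role of an invertible minor of maximal size, with no choice of rows and columns. -/
theorem exists_mul_mul_eq_one (M : Matrix ι κ ℂ) :
    ∃ (P : Matrix (Fin M.rank) ι ℂ) (Q : Matrix κ (Fin M.rank) ℂ), P * M * Q = 1 := by
  classical
  have b := Module.finBasis ℂ (LinearMap.range M.mulVecLin)
  change Module.Basis (Fin M.rank) ℂ (LinearMap.range M.mulVecLin) at b
  choose q hq using fun j => (b j).2
  obtain ⟨g, hg⟩ := LinearMap.exists_leftInverse_of_injective
    ((LinearMap.range M.mulVecLin).subtype ∘ₗ (b.equivFun.symm : (Fin M.rank → ℂ) →ₗ[ℂ] _))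
    (by rw [LinearMap.ker_eq_bot]; exact Subtype.val_injective.comp b.equivFun.symm.injective)
  refine ⟨LinearMap.toMatrix' g, Matrix.of fun i j => q j i, ?_⟩
  ext i j
  have h1 : (M * Matrix.of fun i j => q j i).col j = b j := by
    rw [← hq]; ext i; simp [Matrix.mul_apply, Matrix.mulVec, dotProduct]
  have h2 := LinearMap.congr_fun hg (Pi.single j 1)
  simp only [LinearMap.coe_comp, Function.comp_apply, LinearEquiv.coe_coe,
    Module.Basis.equivFun_symm_apply, LinearMap.id_coe, id_eq, Submodule.coe_subtype] at h2
  rw [Finset.sum_eq_single j (by intro k _ hk; simp [Pi.single_eq_of_ne hk]) (by simp)] at h2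
  rw [Pi.single_eq_same, one_smul, ← h1] at h2
  rw [Matrix.mul_assoc]
  have h3 := congrFun h2 i
  rw [← LinearMap.toMatrix'_mulVec] at h3
  rw [Matrix.one_apply, ← Pi.single_apply, ← h3]
  rfl

/-- Cramer's rule near `v₀`: with N = PφQ invertible at `v₀`, the vector Q · adj(N) · P s is a
preimage of det(N) · s. The identity is checked at points off a hypersurface and extended by
density. -/
theorem exists_smul_eq_mulVec {φ : Matrix ι κ (MvPolynomial σ ℂ)} {r : ℕ}
    (hφ : ∀ v, v ≠ 0 → (φ.map (eval v)).rank = r) {h : MvPolynomial σ ℂ} (h0 : h ≠ 0)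
    {s : ι → MvPolynomial σ ℂ} (hs : ∀ v, v ≠ 0 → eval v h ≠ 0 → InRange φ s v)
    {v₀ : σ → ℂ} (hv₀ : v₀ ≠ 0) :
    ∃ (δ : MvPolynomial σ ℂ) (u : κ → MvPolynomial σ ℂ), eval v₀ δ ≠ 0 ∧ δ • s = φ.mulVec u := by
  classical
  obtain ⟨P, Q, hPQ⟩ := exists_mul_mul_eq_one (φ.map (eval v₀))
  generalize hr' : (φ.map (eval v₀)).rank = r' at P Q hPQ
  obtain rfl : r = r' := by rw [← hr', hφ v₀ hv₀]
  set N : Matrix (Fin r) (Fin r) (MvPolynomial σ ℂ) :=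
    (P.map C : Matrix _ _ (MvPolynomial σ ℂ)) * φ * (Q.map C : Matrix _ _ (MvPolynomial σ ℂ)) with hN
  have evN : ∀ v, N.map (eval v) = P * φ.map (eval v) * Q := by
    intro v
    rw [hN, Matrix.map_mul, Matrix.map_mul]
    congr 1
    · congr 1; ext; simp
    · ext; simp
  have evdet : ∀ v, eval v N.det = (P * φ.map (eval v) * Q).det := by
    intro v; rw [← evN, RingHom.map_det]; rfl
  have hδ : eval v₀ N.det ≠ 0 := by rw [evdet, hPQ]; simp
  refine ⟨N.det, (Q.map C).mulVec (N.adjugate.mulVec ((P.map C).mulVec s)), hδ, ?_⟩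
  obtain ⟨i₀, hi₀⟩ : ∃ i, v₀ i ≠ 0 := by
    by_contra! hc; exact hv₀ (funext hc)
  have hd0 : N.det ≠ 0 := by rintro hd; simp [hd] at hδ
  refine ext_of_evalVec (X i₀ * h * N.det) (mul_ne_zero (mul_ne_zero (X_ne_zero _) h0) hd0) ?_
  intro v hv
  simp only [map_mul, eval_X, mul_ne_zero_iff] at hv
  obtain ⟨⟨hv1, hv2⟩, hv3⟩ := hv
  have hvn : v ≠ 0 := by rintro rfl; simp at hv1
  have hmem := hs v hvn hv2
  set F := φ.map (eval v) with hF
  have hM : IsUnit (P * F * Q) := by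
    rw [Matrix.isUnit_iff_isUnit_det, ← evdet]; exact hv3.isUnit
  -- Where det N ≠ 0 the columns of φQ already span the column space of φ, because the rank of φ is
  -- no larger there than at `v₀`. Hence s = φQy pointwise.
  have hrQ : (F * Q).rank = r := by
    apply le_antisymm
    · simpa using Matrix.rank_le_card_width (F * Q)
    · have := Matrix.rank_mul_le_right P (F * Q)
      rw [← Matrix.mul_assoc, Matrix.rank_of_isUnit _ hM] at this
      simpa using this
  have hle : LinearMap.range (F * Q).mulVecLin ≤ LinearMap.range F.mulVecLin := by
    rw [Matrix.mulVecLin_mul]; exact LinearMap.range_comp_le_range _ _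
  have heq : LinearMap.range (F * Q).mulVecLin = LinearMap.range F.mulVecLin := by
    apply Submodule.eq_of_le_of_finrank_eq hle
    change (F * Q).rank = F.rank
    rw [hrQ, hφ v hvn]
  rw [InRange, ← hF, ← heq] at hmem
  obtain ⟨y, hy⟩ := hmem
  have e1 : evalVec v ((Q.map C).mulVec (N.adjugate.mulVec ((P.map C).mulVec s))) =
      Q.mulVec ((P * F * Q).adjugate.mulVec (P.mulVec (evalVec v s))) := by
    rw [evalVec_mulVec, evalVec_mulVec, evalVec_mulVec]
    have h1 : (Q.map C).map (eval v) = Q := by ext; simp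
    have h2 : (P.map C).map (eval v) = P := by ext; simp
    have h3 : N.adjugate.map (eval v) = (P * F * Q).adjugate := by
      rw [← evN]; exact RingHom.map_adjugate (eval v) N
    rw [h1, h2, h3]
  rw [evalVec_smul, evalVec_mulVec, e1, ← hF, ← hy, evdet]
  simp only [Matrix.mulVecLin_apply, Matrix.mulVec_mulVec]
  rw [show (F * (Q * ((P * F * Q).adjugate * (P * (F * Q))))) =
    F * Q * ((P * F * Q).adjugate * (P * F * Q)) by simp only [Matrix.mul_assoc],
    Matrix.adjugate_mul, Matrix.mul_smul, Matrix.mul_one, Matrix.smul_mulVec]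

/-- The image of a matrix of constant rank is a subbundle, hence closed: membership off a
hypersurface propagates to all nonzero points. -/
theorem InRange.of_generic {φ : Matrix ι κ (MvPolynomial σ ℂ)} {r : ℕ}
    (hφ : ∀ v, v ≠ 0 → (φ.map (eval v)).rank = r) {h : MvPolynomial σ ℂ} (h0 : h ≠ 0)
    {s : ι → MvPolynomial σ ℂ} (hs : ∀ v, v ≠ 0 → eval v h ≠ 0 → InRange φ s v)
    {v : σ → ℂ} (hv : v ≠ 0) : InRange φ s v := by
  obtain ⟨δ, u, hδ, e⟩ := exists_smul_eq_mulVec hφ h0 hs hv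
  have h1 := congrArg (evalVec v) e
  rw [evalVec_smul, evalVec_mulVec] at h1
  refine ⟨(eval v δ)⁻¹ • evalVec v u, ?_⟩
  rw [map_smul, Matrix.mulVecLin_apply, ← h1, smul_smul, inv_mul_cancel₀ hδ, one_smul]

/-- The polynomials p for which p • s lifts form an ideal. By Cramer's rule it has no zero other
than possibly the origin, so the Nullstellensatz puts a power of each coordinate in it. -/
theorem exists_pow_smul_eq_mulVec [Finite σ] {φ : Matrix ι κ (MvPolynomial σ ℂ)} {r : ℕ}
    (hφ : ∀ v, v ≠ 0 → (φ.map (eval v)).rank = r)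
    {s : ι → MvPolynomial σ ℂ} (hs : ∀ v, v ≠ 0 → InRange φ s v) :
    ∃ N : ℕ, ∀ m, N ≤ m → ∀ i, ∃ u, (X i : MvPolynomial σ ℂ) ^ m • s = φ.mulVec u := by
  classical
  cases nonempty_fintype σ
  let J : Ideal (MvPolynomial σ ℂ) :=
    (LinearMap.range φ.mulVecLin).comap (LinearMap.toSpanSingleton _ _ s)
  have hJ : ∀ p, p ∈ J ↔ ∃ u, p • s = φ.mulVec u := by
    intro p
    simp only [J, Submodule.mem_comap, LinearMap.mem_range, LinearMap.toSpanSingleton_apply,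
      Matrix.mulVecLin_apply, eq_comm]
  have h1 : ∀ i, (X i : MvPolynomial σ ℂ) ∈ J.radical := by
    intro i
    rw [← vanishingIdeal_zeroLocus_eq_radical (K := ℂ), mem_vanishingIdeal_iff]
    intro v hv
    by_contra hi
    have hv0 : v ≠ 0 := by rintro rfl; simp at hi
    obtain ⟨δ, u, hδ, e⟩ := exists_smul_eq_mulVec hφ one_ne_zero (fun v hv _ => hs v hv) hv0
    exact hδ (by simpa [aeval_eq_eval] using hv δ ((hJ δ).2 ⟨u, e⟩))
  choose N hN using h1
  refine ⟨∑ i, N i, fun m hm i => (hJ _).1 ?_⟩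
  exact Ideal.pow_mem_of_pow_mem _ (hN i) (le_trans (Finset.single_le_sum (fun _ _ => Nat.zero_le _)
    (Finset.mem_univ i)) hm)

end ConstantRank

/-! ### Forms of integral degree -/

section Forms

variable {σ ι κ : Type*}

/-- `p` is a form of degree `d`, in any set of variables. -/
def Homog (p : MvPolynomial σ ℂ) (d : ℤ) : Prop := ∀ m ∈ p.support, (m.degree : ℤ) = d

theorem homog_iff {p : MvPolynomial σ ℂ} {d : ℤ} :
    Homog p d ↔ ∀ m, coeff m p ≠ 0 → (m.degree : ℤ) = d := by
  simp [Homog, mem_support_iff]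

theorem homog_natCast_iff {p : MvPolynomial σ ℂ} {d : ℕ} : Homog p d ↔ p.IsHomogeneous d := by
  rw [homog_iff]
  simp only [IsHomogeneous, IsWeightedHomogeneous, Nat.cast_inj, Finsupp.degree_eq_weight_one]
  rfl

theorem homog_zero (d : ℤ) : Homog (0 : MvPolynomial σ ℂ) d := by simp [Homog]

theorem Homog.eq_zero {p : MvPolynomial σ ℂ} {d : ℤ} (h : Homog p d) (hd : d < 0) : p = 0 := by
  rw [homog_iff] at h
  ext m
  by_contra hm
  have := h m (by simpa using hm)
  omega

theorem Homog.add {p q : MvPolynomial σ ℂ} {d : ℤ} (hp : Homog p d) (hq : Homog q d) :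
    Homog (p + q) d := by
  rw [homog_iff] at *
  intro m hm
  by_cases h : coeff m p = 0
  · exact hq m (by simpa [h] using hm)
  · exact hp m h

theorem Homog.mul {p q : MvPolynomial σ ℂ} {d e : ℤ} (hp : Homog p d) (hq : Homog q e) :
    Homog (p * q) (d + e) := by
  classical
  rw [homog_iff] at *
  intro m hm
  rw [coeff_mul] at hm
  obtain ⟨x, hx, hne⟩ := Finset.exists_ne_zero_of_sum_ne_zero hm
  rw [Finset.HasAntidiagonal.mem_antidiagonal] at hx
  rw [← hx, map_add, Nat.cast_add, hp _ (left_ne_zero_of_mul hne), hq _ (right_ne_zero_of_mul hne)]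

theorem Homog.sum {s : Finset ι} {p : ι → MvPolynomial σ ℂ} {d : ℤ} (h : ∀ i ∈ s, Homog (p i) d) :
    Homog (∑ i ∈ s, p i) d := by
  classical
  induction s using Finset.induction_on with
  | empty => exact homog_zero d
  | insert a s ha ih =>
    rw [Finset.sum_insert ha]
    exact (h a (by simp)).add (ih fun i hi => h i (by simp [hi]))

theorem homog_C (a : ℂ) : Homog (C a : MvPolynomial σ ℂ) 0 :=
  homog_natCast_iff.2 (isHomogeneous_C σ a)

theorem homog_X (i : σ) : Homog (X i : MvPolynomial σ ℂ) 1 :=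
  homog_natCast_iff.2 (isHomogeneous_X ℂ i)

theorem homog_X_pow (i : σ) (n : ℕ) : Homog ((X i : MvPolynomial σ ℂ) ^ n) n :=
  homog_natCast_iff.2 (isHomogeneous_X_pow i n)

theorem Homog.C_mul {p : MvPolynomial σ ℂ} {d : ℤ} (h : Homog p d) (a : ℂ) :
    Homog (C a * p) d := by simpa using (homog_C a).mul h

/-- The component of degree `d` of a polynomial. -/
noncomputable def formPart (d : ℤ) : MvPolynomial σ ℂ →ₗ[ℂ] MvPolynomial σ ℂ :=
  if 0 ≤ d then homogeneousComponent d.toNat else 0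

theorem coeff_formPart (d : ℤ) (p : MvPolynomial σ ℂ) (m : σ →₀ ℕ) :
    coeff m (formPart d p) = if (m.degree : ℤ) = d then coeff m p else 0 := by
  unfold formPart
  split_ifs with h1 h2 h2
  · rw [coeff_homogeneousComponent, if_pos (by omega)]
  · rw [coeff_homogeneousComponent, if_neg (by omega)]
  · omega
  · simp

theorem homog_formPart (d : ℤ) (p : MvPolynomial σ ℂ) : Homog (formPart d p) d := by
  rw [homog_iff]
  intro m hm
  rw [coeff_formPart] at hm
  by_contra h
  simp [h] at hm

theorem Homog.formPart_eq {p : MvPolynomial σ ℂ} {d : ℤ} (h : Homog p d) : formPart d p = p := by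
  rw [homog_iff] at h
  ext m
  rw [coeff_formPart]
  split_ifs with hm
  · rfl
  · by_contra hc
    exact hm (h m (Ne.symm hc))

theorem Homog.formPart_mul {p : MvPolynomial σ ℂ} {d : ℤ} (h : Homog p d) (e : ℤ)
    (q : MvPolynomial σ ℂ) : formPart e (p * q) = p * formPart (e - d) q := by
  classical
  rw [homog_iff] at h
  ext m
  rw [coeff_formPart, coeff_mul, coeff_mul,
    ← Finset.sum_const_zero (s := Finset.HasAntidiagonal.antidiagonal m), ← Finset.sum_ite_irrel]
  · refine Finset.sum_congr rfl fun x hx => ?_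
    rw [Finset.HasAntidiagonal.mem_antidiagonal] at hx
    by_cases hx1 : coeff x.1 p = 0
    · simp [hx1]
    · have h1 := h _ hx1
      have h2 : (m.degree : ℤ) = x.1.degree + x.2.degree := by rw [← hx, map_add]; push_cast; rfl
      rw [coeff_formPart]
      by_cases h3 : (m.degree : ℤ) = e
      · rw [if_pos h3, if_pos (by omega)]
      · rw [if_neg h3, if_neg (by omega), mul_zero]

theorem formPart_eq_zero {p : MvPolynomial σ ℂ} {d : ℤ} (h : (p.totalDegree : ℤ) < d) :
    formPart d p = 0 := by
  unfold formPart
  split_ifs with h0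
  · exact homogeneousComponent_eq_zero _ _ (by omega)
  · rfl

/-- A monomial either is divisible by some `X i ^ N` or has all its exponents below `N`, which
bounds its degree. -/
theorem exists_add_mem_span_X_pow [Fintype σ] (N : ℕ) (p : MvPolynomial σ ℂ) :
    ∃ q r : MvPolynomial σ ℂ, p = q + r ∧ q.totalDegree ≤ Fintype.card σ * N ∧
      r ∈ Ideal.span (Set.range fun i : σ => (X i : MvPolynomial σ ℂ) ^ N) := by
  classical
  induction p using MvPolynomial.monomial_add_induction_on with
  | C a => exact ⟨C a, 0, by simp, by simp, by simp⟩
  | monomial_add m a p hm ha ih =>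
    obtain ⟨q, r, rfl, hq, hr⟩ := ih
    by_cases h : ∃ i, N ≤ m i
    · obtain ⟨i, hi⟩ := h
      refine ⟨q, monomial m a + r, by ring, hq, Ideal.add_mem _ ?_ hr⟩
      have : monomial m a = monomial (m - Finsupp.single i N) a * X i ^ N := by
        rw [X_pow_eq_monomial, monomial_mul, mul_one,
          tsub_add_cancel_of_le (Finsupp.single_le_iff.2 hi)]
      rw [this]
      exact Ideal.mul_mem_left _ _ (Ideal.subset_span ⟨i, rfl⟩)
    · push Not at h
      refine ⟨monomial m a + q, r, by ring, ?_, hr⟩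
      refine (totalDegree_add _ _).trans (max_le ?_ hq)
      refine (totalDegree_monomial_le _ _).trans ?_
      rw [Finsupp.sum_fintype _ _ (by simp)]
      calc _ ≤ ∑ _i : σ, N := Finset.sum_le_sum fun i _ => (h i).le
        _ = _ := by simp

/-- The vectors of forms of given degrees. -/
def formVec (a : ι → ℤ) : Submodule ℂ (ι → MvPolynomial σ ℂ) where
  carrier := {u | ∀ i, Homog (u i) (a i)}
  add_mem' hu hv i := (hu i).add (hv i)
  zero_mem' _ := homog_zero _
  smul_mem' z u hu i := by
    change Homog (z • u i) (a i)
    rw [smul_eq_C_mul]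
    exact (hu i).C_mul z

/-- The component of given degrees of a vector of polynomials. -/
noncomputable def vecPart (a : ι → ℤ) : (ι → MvPolynomial σ ℂ) →ₗ[ℂ] (ι → MvPolynomial σ ℂ) :=
  LinearMap.pi fun i => formPart (a i) ∘ₗ LinearMap.proj i

@[simp] theorem vecPart_apply (a : ι → ℤ) (u : ι → MvPolynomial σ ℂ) (i : ι) :
    vecPart a u i = formPart (a i) (u i) := rfl

theorem vecPart_mem (a : ι → ℤ) (u : ι → MvPolynomial σ ℂ) : vecPart a u ∈ formVec a :=
  fun _ => homog_formPart _ _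

theorem vecPart_eq {a : ι → ℤ} {u : ι → MvPolynomial σ ℂ} (h : u ∈ formVec a) :
    vecPart a u = u := funext fun i => (h i).formPart_eq

variable [Fintype κ]

theorem vecPart_mulVec {φ : Matrix ι κ (MvPolynomial σ ℂ)} {a : κ → ℤ} {b : ι → ℤ}
    (hφ : ∀ i j, Homog (φ i j) (b i - a j)) (t : ℤ) (u : κ → MvPolynomial σ ℂ) :
    vecPart (fun i => b i + t) (φ.mulVec u) = φ.mulVec (vecPart (fun j => a j + t) u) := by
  ext1 i
  simp only [vecPart_apply, Matrix.mulVec, dotProduct, map_sum]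
  refine Finset.sum_congr rfl fun j _ => ?_
  rw [(hφ i j).formPart_mul, show b i + t - (b i - a j) = a j + t by ring]

theorem mulVec_mem_formVec {φ : Matrix ι κ (MvPolynomial σ ℂ)} {a : κ → ℤ} {b : ι → ℤ}
    (hφ : ∀ i j, Homog (φ i j) (b i - a j)) {t : ℤ} {u : κ → MvPolynomial σ ℂ}
    (hu : u ∈ formVec fun j => a j + t) : φ.mulVec u ∈ formVec fun i => b i + t := by
  rw [← vecPart_eq hu, ← vecPart_mulVec hφ]
  exact vecPart_mem _ _

/-- Sections of high degree that lie pointwise in the image of a matrix of forms of constant rank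
lift to sections. -/
theorem exists_forall_exists_mulVec_eq [Fintype ι] [Finite σ]
    {φ : Matrix ι κ (MvPolynomial σ ℂ)} {a : κ → ℤ} {b : ι → ℤ}
    (hφ : ∀ i j, Homog (φ i j) (b i - a j)) {r : ℕ}
    (hr : ∀ v, v ≠ 0 → (φ.map (eval v)).rank = r) :
    ∃ D : ℤ, ∀ t, D ≤ t → ∀ s ∈ formVec fun i => b i + t, (∀ v, v ≠ 0 → InRange φ s v) →
      ∃ u ∈ formVec fun j => a j + t, φ.mulVec u = s := by
  classical
  cases nonempty_fintype σ
  let M : Submodule (MvPolynomial σ ℂ) (ι → MvPolynomial σ ℂ) :=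
    { carrier := {s | ∀ v, v ≠ 0 → InRange φ s v}
      add_mem' := fun {s t} hs ht v hv => by
        change evalVec v (s + t) ∈ _
        rw [map_add]
        exact add_mem (hs v hv) (ht v hv)
      zero_mem' := fun v _ => by
        change evalVec v 0 ∈ _
        rw [map_zero]
        exact zero_mem _
      smul_mem' := fun p s hs v hv => by
        change evalVec v (p • s) ∈ _
        rw [evalVec_smul]
        exact Submodule.smul_mem _ _ (hs v hv) }
  obtain ⟨S, hS⟩ : M.FG := IsNoetherian.noetherian M
  have hSM : ∀ g : S, ∀ v, v ≠ 0 → InRange φ (g : ι → MvPolynomial σ ℂ) v := by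
    intro g
    have : (g : ι → MvPolynomial σ ℂ) ∈ M := hS ▸ Submodule.subset_span g.2
    exact this
  choose N hN using fun g : S => exists_pow_smul_eq_mulVec hr (hSM g)
  set N' := ∑ g, N g with hN'
  have hle : ∀ g, N g ≤ N' := fun g => Finset.single_le_sum (fun _ _ => Nat.zero_le _)
    (Finset.mem_univ g)
  have hideal : ∀ g : S, ∀ p ∈ Ideal.span (Set.range fun i : σ => (X i : MvPolynomial σ ℂ) ^ N'),
      ∃ u, p • (g : ι → MvPolynomial σ ℂ) = φ.mulVec u := by
    intro g p hp
    have : Ideal.span (Set.range fun i : σ => (X i : MvPolynomial σ ℂ) ^ N') ≤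
        (LinearMap.range φ.mulVecLin).comap (LinearMap.toSpanSingleton _ _ (g : ι → _)) := by
      rw [Ideal.span_le]
      rintro _ ⟨i, rfl⟩
      obtain ⟨u, hu⟩ := hN g N' (hle g) i
      exact ⟨u, by simp [hu]⟩
    obtain ⟨u, hu⟩ := this hp
    exact ⟨u, by simpa using hu.symm⟩
  -- Coefficients on the generators can be reduced modulo the powers `X i ^ N'`, whose multiples of
  -- generators lift. The remainders have degree at most card σ · N', so beyond `D` they contribute
  -- nothing in degrees `b i + t`.
  let D : ℤ := ∑ g : S, ∑ i, ((g : ι → MvPolynomial σ ℂ) i).totalDegree + ∑ i, |b i| +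
    Fintype.card σ * N' + 1
  refine ⟨D, fun t ht s hs hsr => ?_⟩
  have hsM : s ∈ Submodule.span (MvPolynomial σ ℂ) (S : Set (ι → MvPolynomial σ ℂ)) := by
    rw [hS]; exact hsr
  rw [Submodule.mem_span_finset'] at hsM
  obtain ⟨c, hc⟩ := hsM
  choose q r hqr hq hr' using fun g => exists_add_mem_span_X_pow N' (c g)
  choose u hu using fun g => hideal g (r g) (hr' g)
  refine ⟨vecPart (fun j => a j + t) (∑ g, u g), vecPart_mem _ _, ?_⟩
  rw [← vecPart_mulVec hφ]
  have e1 : s = ∑ g, q g • (g : ι → MvPolynomial σ ℂ) + φ.mulVec (∑ g, u g) := by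
    rw [← hc, Matrix.mulVec_sum, ← Finset.sum_add_distrib]
    refine Finset.sum_congr rfl fun g _ => ?_
    rw [← hu, ← add_smul, ← hqr]
  have e2 : vecPart (fun i => b i + t) (∑ g, q g • (g : ι → MvPolynomial σ ℂ)) = 0 := by
    rw [map_sum]
    refine Finset.sum_eq_zero fun g _ => ?_
    ext1 i
    refine formPart_eq_zero ?_
    have h1 := totalDegree_mul (q g) ((g : ι → MvPolynomial σ ℂ) i)
    have h2 : ((g : ι → MvPolynomial σ ℂ) i).totalDegree ≤
        ∑ g : S, ∑ i, ((g : ι → MvPolynomial σ ℂ) i).totalDegree :=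
      (Finset.single_le_sum (f := fun i => ((g : ι → MvPolynomial σ ℂ) i).totalDegree)
        (fun _ _ => Nat.zero_le _) (Finset.mem_univ i)).trans
      (Finset.single_le_sum (f := fun g : S => ∑ i, ((g : ι → MvPolynomial σ ℂ) i).totalDegree)
        (fun _ _ => Nat.zero_le _) (Finset.mem_univ g))
    have h3 : |b i| ≤ ∑ i, |b i| := Finset.single_le_sum (f := fun i => |b i|)
      (fun _ _ => abs_nonneg _) (Finset.mem_univ i)
    have h4 := neg_abs_le (b i)
    have h5 := hq g
    change ((q g * (g : ι → MvPolynomial σ ℂ) i).totalDegree : ℤ) < b i + t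
    zify at h1 h2 h5
    simp only [D] at ht
    push_cast at ht
    linarith
  conv_rhs => rw [← vecPart_eq hs, e1, map_add, e2, zero_add]

end Forms

/-! ### Spaces of sections and their dimensions -/

/-- The linear algebra behind h⁰(F(t)) ≤ h⁰(F|_H(t)) + h⁰(F(t - 1)): `f` is restriction to a
hyperplane H or to a point, `g` is multiplication by the equation. It also serves for a kernel count
with `g` the identity. -/
theorem finrank_le_add_of_map {E F G : Type*} [AddCommGroup E] [Module ℂ E] [AddCommGroup F]
    [Module ℂ F] [AddCommGroup G] [Module ℂ G] (W : Submodule ℂ E) (W' : Submodule ℂ F)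
    (U : Submodule ℂ G) [FiniteDimensional ℂ W] [FiniteDimensional ℂ W'] [FiniteDimensional ℂ U]
    (f : E →ₗ[ℂ] F) (g : G →ₗ[ℂ] E) (h₁ : ∀ w ∈ W, f w ∈ W')
    (h₂ : ∀ w ∈ W, f w = 0 → ∃ u ∈ U, g u = w) :
    Module.finrank ℂ W ≤ Module.finrank ℂ W' + Module.finrank ℂ U := by
  rw [← LinearMap.finrank_range_add_finrank_ker (f.domRestrict W)]
  refine add_le_add ?_ ?_
  · refine Submodule.finrank_mono ?_
    rintro _ ⟨w, rfl⟩
    exact h₁ w w.2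
  · rw [← LinearMap.finrank_range_of_inj (f := W.subtype.domRestrict (LinearMap.ker (f.domRestrict W)))
      (Subtype.val_injective.comp Subtype.val_injective)]
    refine (Submodule.finrank_mono (t := U.map g) ?_).trans (Submodule.finrank_map_le _ _)
    rintro _ ⟨w, rfl⟩
    exact h₂ _ w.1.2 w.2

section Dim

variable {σ ι : Type*}

/-- The forms of degree `d`. -/
def forms (σ : Type*) (d : ℤ) : Submodule ℂ (MvPolynomial σ ℂ) where
  carrier := {p | Homog p d}
  add_mem' hp hq := hp.add hq
  zero_mem' := homog_zero _
  smul_mem' z p hp := by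
    change Homog (z • p) d
    rw [smul_eq_C_mul]
    exact Homog.C_mul hp z

theorem forms_eq_bot {d : ℤ} (hd : d < 0) : forms σ d = ⊥ :=
  (Submodule.eq_bot_iff _).2 fun _ hp => Homog.eq_zero hp hd

theorem forms_natCast (d : ℕ) : forms σ (d : ℤ) = homogeneousSubmodule σ ℂ d := by
  ext p
  exact homog_natCast_iff

instance [Finite σ] (d : ℤ) : FiniteDimensional ℂ (forms σ d) := by
  rcases lt_or_ge d 0 with h | h
  · rw [forms_eq_bot h]; infer_instance
  · lift d to ℕ using h
    rw [forms_natCast]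
    exact Module.Finite.iff_fg.2 (homogeneousSubmodule_fg σ ℂ d)

theorem finrank_forms (k d : ℕ) :
    Module.finrank ℂ (forms (Fin (k + 1)) (d : ℤ)) = (d + k).choose k := by
  classical
  rw [forms_natCast, homogeneousSubmodule_eq_finsupp_supported]
  have hs : {m : Fin (k + 1) →₀ ℕ | m.degree = d} =
      ↑(Finset.finsuppAntidiag (Finset.univ : Finset (Fin (k + 1))) d) := by
    ext m
    simp [Finset.mem_finsuppAntidiag, Finsupp.degree_eq_sum]
  refine (Module.finrank_eq_nat_card_basis (basisRestrictSupport ℂ _)).trans ?_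
  rw [hs, Nat.card_coe_set_eq, Set.ncard_coe_finset, Finset.card_finsuppAntidiag_nat_eq_choose,
    Finset.card_univ, Fintype.card_fin, show k + 1 + d - 1 = d + k by omega,
    Nat.choose_symm_add]

/-- The formula reaches down to -2 because (d + 1)(d + 2) vanishes at -1 and -2. -/
theorem two_mul_finrank_forms_three {d : ℤ} (hd : -2 ≤ d) :
    2 * (Module.finrank ℂ (forms (Fin 3) d) : ℤ) = (d + 1) * (d + 2) := by
  rcases lt_or_ge d 0 with h | h
  · rw [forms_eq_bot h, finrank_bot]
    obtain rfl | rfl : d = -1 ∨ d = -2 := by omega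
    all_goals simp
  · lift d to ℕ using h
    rw [finrank_forms 2 d]
    rw [Nat.choose_two_right]
    have h2 : 2 ∣ (d + 2) * (d + 2 - 1) := even_iff_two_dvd.1 (Nat.even_mul_pred_self _)
    rw [show (d + 2 - 1) = d + 1 by omega] at *
    obtain ⟨e, he⟩ := h2
    rw [he, Nat.mul_div_cancel_left _ two_pos]
    zify at he
    linarith

theorem finrank_forms_two {d : ℤ} (hd : -1 ≤ d) :
    (Module.finrank ℂ (forms (Fin 2) d) : ℤ) = d + 1 := by
  rcases lt_or_ge d 0 with h | h
  · rw [forms_eq_bot h, finrank_bot]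
    omega
  · lift d to ℕ using h
    rw [finrank_forms 1 d]
    simp

/-- A vector of forms is a family of forms. -/
def formVecEquiv (a : ι → ℤ) :
    (formVec a : Submodule ℂ (ι → MvPolynomial σ ℂ)) ≃ₗ[ℂ] (∀ i, forms σ (a i)) where
  toFun u i := ⟨u.1 i, u.2 i⟩
  invFun u := ⟨fun i => (u i).1, fun i => (u i).2⟩
  map_add' _ _ := rfl
  map_smul' _ _ := rfl

instance [Finite σ] [Finite ι] (a : ι → ℤ) :
    FiniteDimensional ℂ (formVec a : Submodule ℂ (ι → MvPolynomial σ ℂ)) :=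
  Module.Finite.equiv (formVecEquiv a).symm

theorem finrank_formVec [Finite σ] [Fintype ι] (a : ι → ℤ) :
    Module.finrank ℂ (formVec a : Submodule ℂ (ι → MvPolynomial σ ℂ)) =
      ∑ i, Module.finrank ℂ (forms σ (a i)) := by
  rw [(formVecEquiv a).finrank_eq, Module.finrank_pi_fintype]

end Dim

/-! ### Restriction to a coordinate hyperplane -/

section Restrict

variable {k : ℕ} {ι κ : Type*}

/-- Restriction of polynomials to the hyperplane `x₀ = 0`. -/
noncomputable def restrict (k : ℕ) : MvPolynomial (Fin (k + 1)) ℂ →ₐ[ℂ] MvPolynomial (Fin k) ℂ :=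
  aeval (Fin.cases 0 X)

theorem eval_restrict (v : Fin k → ℂ) (p : MvPolynomial (Fin (k + 1)) ℂ) :
    eval v (restrict k p) = eval (Fin.cons 0 v) p := by
  have : ((aeval v : MvPolynomial (Fin k) ℂ →ₐ[ℂ] ℂ).comp (restrict k)) =
      (aeval (Fin.cons 0 v : Fin (k + 1) → ℂ)) := by
    ext i
    refine Fin.cases ?_ (fun i => ?_) i <;> simp [restrict]
  simpa [aeval_eq_eval] using AlgHom.congr_fun this p

theorem Homog.restrict {p : MvPolynomial (Fin (k + 1)) ℂ} {d : ℤ} (h : Homog p d) :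
    Homog (restrict k p) d := by
  rcases lt_or_ge d 0 with hd | hd
  · rw [h.eq_zero hd, map_zero]; exact homog_zero d
  · lift d to ℕ using hd
    rw [homog_natCast_iff] at *
    have := h.aeval (Fin.cases 0 X : Fin (k + 1) → MvPolynomial (Fin k) ℂ) (n := 1) (fun i => by
      refine Fin.cases ?_ (fun i => ?_) i
      · exact isHomogeneous_zero _ _ _
      · exact isHomogeneous_X _ _)
    rw [one_mul] at this
    exact this

theorem exists_eq_X_mul_of_restrict_eq_zero {p : MvPolynomial (Fin (k + 1)) ℂ}
    (h : restrict k p = 0) : ∃ q, p = X 0 * q := by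
  have key : ∀ p : MvPolynomial (Fin (k + 1)) ℂ, (X 0 : MvPolynomial (Fin (k + 1)) ℂ) ∣
      p - rename Fin.succ (restrict k p) := by
    intro p
    induction p using MvPolynomial.induction_on with
    | C a => simp [restrict]
    | add p q hp hq =>
      rw [map_add, map_add, add_sub_add_comm]
      exact dvd_add hp hq
    | mul_X p i hp =>
      rw [map_mul, map_mul]
      refine Fin.cases ?_ (fun i => ?_) i
      · simp [restrict]
      · have : rename Fin.succ (restrict k (X i.succ)) = X i.succ := by simp [restrict]
        rw [this, ← sub_mul]
        exact dvd_mul_of_dvd_left hp _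
  have := key p
  rw [h, map_zero, sub_zero] at this
  exact this

theorem Homog.exists_eq_X_mul {p : MvPolynomial (Fin (k + 1)) ℂ} {d : ℤ} (hp : Homog p d)
    (h : PlaneBundle.restrict k p = 0) : ∃ q, Homog q (d - 1) ∧ p = X 0 * q := by
  obtain ⟨q, hq⟩ := exists_eq_X_mul_of_restrict_eq_zero h
  refine ⟨formPart (d - 1) q, homog_formPart _ _, ?_⟩
  rw [← (homog_X 0).formPart_mul, ← hq, hp.formPart_eq]

theorem Homog.eq_zero_of_eval_one {p : MvPolynomial (Fin 1) ℂ} {d : ℤ} (hp : Homog p d)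
    (h : eval 1 p = 0) : p = 0 := by
  rcases lt_or_ge d 0 with hd | hd
  · exact hp.eq_zero hd
  · lift d to ℕ using hd
    rw [homog_natCast_iff] at hp
    have hp' : p = monomial (Finsupp.single 0 d) (coeff (Finsupp.single 0 d) p) := by
      ext m
      rw [coeff_monomial]
      split_ifs with hm
      · rw [hm]
      · refine hp.coeff_eq_zero fun hd => hm ?_
        ext
        rw [Finsupp.degree_eq_sum] at hd
        simpa using hd.symm
    rw [hp', eval_monomial] at h
    rw [hp', show coeff (Finsupp.single 0 d) p = 0 by simpa using h, monomial_zero]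

/-- Multiplication of vectors by the coordinate `x₀`. -/
noncomputable def mulX (k : ℕ) (ι : Type*) : (ι → MvPolynomial (Fin (k + 1)) ℂ) →ₗ[ℂ]
    (ι → MvPolynomial (Fin (k + 1)) ℂ) where
  toFun u := (X 0 : MvPolynomial (Fin (k + 1)) ℂ) • u
  map_add' _ _ := smul_add _ _ _
  map_smul' _ _ := smul_comm _ _ _

theorem mulX_apply (u : ι → MvPolynomial (Fin (k + 1)) ℂ) :
    mulX k ι u = (X 0 : MvPolynomial (Fin (k + 1)) ℂ) • u := rfl

/-- Restriction of vectors to the hyperplane `x₀ = 0`. -/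
noncomputable def restrictVec (k : ℕ) (ι : Type*) : (ι → MvPolynomial (Fin (k + 1)) ℂ) →ₗ[ℂ]
    (ι → MvPolynomial (Fin k) ℂ) :=
  LinearMap.pi fun i => (restrict k).toLinearMap ∘ₗ LinearMap.proj i

@[simp] theorem restrictVec_apply (u : ι → MvPolynomial (Fin (k + 1)) ℂ) (i : ι) :
    restrictVec k ι u i = restrict k (u i) := rfl

theorem exists_eq_mulX {a : ℤ} {u : ι → MvPolynomial (Fin (k + 1)) ℂ}
    (hu : u ∈ formVec fun _ => a) (h : restrictVec k ι u = 0) :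
    ∃ w ∈ formVec fun _ => a - 1, mulX k ι w = u := by
  choose w hw hw' using fun i => (hu i).exists_eq_X_mul (congrFun h i)
  exact ⟨w, hw, funext fun i => (hw' i).symm⟩

theorem evalVec_restrictVec (v : Fin k → ℂ) (u : ι → MvPolynomial (Fin (k + 1)) ℂ) :
    evalVec v (restrictVec k ι u) = evalVec (Fin.cons 0 v : Fin (k + 1) → ℂ) u := by
  ext i
  simp [eval_restrict]

theorem map_restrict_map_eval (φ : Matrix ι κ (MvPolynomial (Fin (k + 1)) ℂ)) (v : Fin k → ℂ) :
    (φ.map (restrict k)).map (eval v) = φ.map (eval (Fin.cons 0 v : Fin (k + 1) → ℂ)) := by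
  ext i j
  simp [eval_restrict]

theorem cons_zero_ne_zero {v : Fin k → ℂ} (hv : v ≠ 0) : (Fin.cons 0 v : Fin (k + 1) → ℂ) ≠ 0 := by
  rintro h
  apply hv
  ext i
  simpa using congrFun h i.succ

end Restrict

/-! ### Skew-symmetric matrices of linear forms -/

/-- An isotropic subspace of a nondegenerate alternating space has at most half its dimension; here
the space is the image of `A` with the form (Aa, Ab) ↦ a · Ab. Concretely, A⁻¹(M) has dimension dim
M + dim ker A and annihilates M. -/
theorem two_mul_finrank_le_rank {ι : Type*} [Fintype ι] {A : Matrix ι ι ℂ} (hA : A.transpose = -A)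
    (M : Submodule ℂ (ι → ℂ)) (hM : ∀ w ∈ M, ∀ w' ∈ M, ∃ a, A.mulVec a = w' ∧ w ⬝ᵥ a = 0) :
    2 * Module.finrank ℂ M ≤ A.rank := by
  classical
  set T := M.comap A.mulVecLin with hT
  have hMr : M ≤ LinearMap.range A.mulVecLin := fun w hw => by
    obtain ⟨a, ha, -⟩ := hM w hw w hw
    exact ⟨a, ha⟩
  have hTdim : Module.finrank ℂ T = Module.finrank ℂ M +
      Module.finrank ℂ (LinearMap.ker A.mulVecLin) := by
    rw [← LinearMap.finrank_range_add_finrank_ker (A.mulVecLin.domRestrict T)]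
    congr 1
    · rw [LinearMap.range_domRestrict, hT, Submodule.map_comap_eq_of_le hMr]
    · rw [LinearMap.ker_domRestrict]
      refine LinearEquiv.finrank_eq (Submodule.comapSubtypeEquivOfLe ?_)
      intro a ha
      rw [hT, Submodule.mem_comap, LinearMap.mem_ker.1 ha]
      exact zero_mem _
  -- The hypothesis supplies one preimage orthogonal to `w`; two preimages differ by a kernel
  -- vector, which is orthogonal to the image by skew-symmetry.
  have horth : ∀ w ∈ M, ∀ a ∈ T, w ⬝ᵥ a = 0 := by
    intro w hw a ha
    obtain ⟨a', ha', hwa'⟩ := hM w hw _ ha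
    obtain ⟨b, rfl⟩ := hMr hw
    have h1 : A.mulVec (a - a') = 0 := by
      rw [Matrix.mulVec_sub, ha']; simp
    have h2 : (A.mulVecLin b) ⬝ᵥ (a - a') = 0 := by
      rw [Matrix.mulVecLin_apply, ← Matrix.vecMul_transpose, ← Matrix.dotProduct_mulVec, hA,
        Matrix.neg_mulVec, h1]
      simp
    rw [dotProduct_sub, hwa', sub_zero] at h2
    exact h2
  have hle : T.map (dotProductEquiv ℂ ι : (ι → ℂ) →ₗ[ℂ] _) ≤ M.dualAnnihilator := by
    rintro _ ⟨a, ha, rfl⟩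
    rw [Submodule.mem_dualAnnihilator]
    intro w hw
    simpa [dotProduct_comm] using horth w hw a ha
  have h3 := Submodule.finrank_mono hle
  rw [LinearEquiv.finrank_map_eq] at h3
  have h4 := Subspace.finrank_add_finrank_dualAnnihilator_eq M
  have h5 := LinearMap.finrank_range_add_finrank_ker A.mulVecLin
  change A.rank + _ = _ at h5
  omega

/-- By skew-symmetry the image is the orthogonal complement of the kernel. The kernel has dimension
two, and the nonzero minor says that `u₁`, `u₂` span it. -/
theorem mem_range_of_dotProduct_eq_zero {ι : Type*} [Fintype ι] {A : Matrix ι ι ℂ}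
    (hA : A.transpose = -A) (hr : A.rank + 2 = Fintype.card ι) {u₁ u₂ w : ι → ℂ}
    (h₁ : A.mulVec u₁ = 0) (h₂ : A.mulVec u₂ = 0) {i j : ι} (hij : u₁ i * u₂ j - u₁ j * u₂ i ≠ 0)
    (hw₁ : u₁ ⬝ᵥ w = 0) (hw₂ : u₂ ⬝ᵥ w = 0) : w ∈ LinearMap.range A.mulVecLin := by
  classical
  let U : Matrix (Fin 2) ι ℂ := Matrix.of ![u₁, u₂]
  have hsurj : U.rank = 2 := by
    apply le_antisymm
    · simpa using Matrix.rank_le_card_height U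
    · have h1 := Matrix.rank_of_isUnit (U.submatrix id ![i, j]) (by
        rw [Matrix.isUnit_iff_isUnit_det, Matrix.det_fin_two]
        simpa [U] using hij)
      have h2 := Matrix.rank_submatrix_le U id ![i, j]
      simp only [Fintype.card_fin] at h1
      omega
  have hk : ∀ u, A.mulVec u = 0 → ∀ b, u ⬝ᵥ A.mulVec b = 0 := by
    intro u hu b
    rw [Matrix.dotProduct_mulVec, ← Matrix.mulVec_transpose, hA, Matrix.neg_mulVec, hu]
    simp
  have hmem : ∀ w, w ∈ LinearMap.ker U.mulVecLin ↔ u₁ ⬝ᵥ w = 0 ∧ u₂ ⬝ᵥ w = 0 := by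
    intro w
    rw [LinearMap.mem_ker, Matrix.mulVecLin_apply]
    constructor
    · intro h
      exact ⟨congrFun h 0, congrFun h 1⟩
    · rintro ⟨h1, h2⟩
      ext i
      fin_cases i
      · exact h1
      · exact h2
  have hle : LinearMap.range A.mulVecLin ≤ LinearMap.ker U.mulVecLin := by
    rintro _ ⟨b, rfl⟩
    exact (hmem _).2 ⟨hk _ h₁ b, hk _ h₂ b⟩
  have heq : LinearMap.range A.mulVecLin = LinearMap.ker U.mulVecLin := by
    apply Submodule.eq_of_le_of_finrank_eq hle
    have h5 := LinearMap.finrank_range_add_finrank_ker U.mulVecLin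
    change U.rank + _ = _ at h5
    change A.rank = _
    rw [Module.finrank_fintype_fun_eq_card] at h5
    omega
  rw [heq, hmem]
  exact ⟨hw₁, hw₂⟩

/-! ### Sections of the image and of the kernel; the isotropy bound -/

section Skew

variable {σ ι : Type*} [Fintype ι]

/-- A skew-symmetric matrix of linear forms that has rank `r` at every nonzero point. -/
structure IsSkewPencil (A : Matrix ι ι (MvPolynomial σ ℂ)) (r : ℕ) : Prop where
  linear : ∀ i j, Homog (A i j) 1
  skew : A.transpose = -A
  rank_eq : ∀ v, v ≠ 0 → (A.map (eval v)).rank = r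

/-- The vectors of forms of degree `t` that lie pointwise in the image of a matrix. -/
def rangeSec (A : Matrix ι ι (MvPolynomial σ ℂ)) (t : ℤ) :
    Submodule ℂ (ι → MvPolynomial σ ℂ) where
  carrier := {w | w ∈ formVec (fun _ => t) ∧ ∀ v, v ≠ 0 → InRange A w v}
  add_mem' := fun {w w'} hw hw' => ⟨add_mem hw.1 hw'.1, fun v hv => by
    rw [InRange, map_add]; exact add_mem (hw.2 v hv) (hw'.2 v hv)⟩
  zero_mem' := ⟨zero_mem _, fun v _ => by rw [InRange, map_zero]; exact zero_mem _⟩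
  smul_mem' := fun z w hw => ⟨Submodule.smul_mem _ _ hw.1, fun v hv => by
    rw [InRange, map_smul]; exact Submodule.smul_mem _ _ (hw.2 v hv)⟩

/-- The vectors of forms of degree `t` in the kernel of a matrix. -/
def kerSec (A : Matrix ι ι (MvPolynomial σ ℂ)) (t : ℤ) :
    Submodule ℂ (ι → MvPolynomial σ ℂ) where
  carrier := {u | u ∈ formVec (fun _ => t) ∧ A.mulVec u = 0}
  add_mem' := fun {w w'} hw hw' => ⟨add_mem hw.1 hw'.1, by
    rw [Matrix.mulVec_add, hw.2, hw'.2, add_zero]⟩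
  zero_mem' := ⟨zero_mem _, Matrix.mulVec_zero _⟩
  smul_mem' := fun z w hw => ⟨Submodule.smul_mem _ _ hw.1, by
    rw [Matrix.mulVec_smul, hw.2, smul_zero]⟩

instance [Finite σ] (A : Matrix ι ι (MvPolynomial σ ℂ)) (t : ℤ) :
    FiniteDimensional ℂ (rangeSec A t) :=
  Submodule.finiteDimensional_of_le (S₂ := formVec fun _ => t) fun _ h => h.1

instance [Finite σ] (A : Matrix ι ι (MvPolynomial σ ℂ)) (t : ℤ) :
    FiniteDimensional ℂ (kerSec A t) :=
  Submodule.finiteDimensional_of_le (S₂ := formVec fun _ => t) fun _ h => h.1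

/-- The dimension of the space `rangeSec A t`. -/
noncomputable abbrev dimRange (A : Matrix ι ι (MvPolynomial σ ℂ)) (t : ℤ) : ℕ :=
  Module.finrank ℂ (rangeSec A t)

/-- The dimension of the space `kerSec A t`. -/
noncomputable abbrev dimKer (A : Matrix ι ι (MvPolynomial σ ℂ)) (t : ℤ) : ℕ :=
  Module.finrank ℂ (kerSec A t)

variable {A : Matrix ι ι (MvPolynomial σ ℂ)} {r : ℕ}

theorem IsSkewPencil.dotProduct_mulVec (h : IsSkewPencil A r) (u u' : ι → MvPolynomial σ ℂ) :
    A.mulVec u ⬝ᵥ u' = -(u ⬝ᵥ A.mulVec u') := by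
  rw [← Matrix.vecMul_transpose, ← Matrix.dotProduct_mulVec, h.skew, Matrix.neg_mulVec,
    dotProduct_neg]

theorem IsSkewPencil.map_eval_skew (h : IsSkewPencil A r) (v : σ → ℂ) :
    (A.map (eval v)).transpose = -A.map (eval v) := by
  rw [← Matrix.transpose_map, h.skew]
  ext i j
  simp

theorem Homog.C_of_zero {p : MvPolynomial σ ℂ} (hp : Homog p 0) : ∃ z, p = C z := by
  have := (homog_natCast_iff (d := 0)).1 (by simpa using hp)
  exact ⟨_, totalDegree_eq_zero_iff_eq_C.1 ((totalDegree_zero_iff_isHomogeneous _).2 this)⟩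

/-- The constant vectors that lie everywhere in the image form an isotropic subspace. -/
theorem IsSkewPencil.two_mul_finrank_rangeSec_zero_le [Finite σ] [Nontrivial σ]
    (h : IsSkewPencil A r) : 2 * dimRange A 0 ≤ r := by
  classical
  rw [dimRange]
  obtain ⟨i, j, hij⟩ := exists_pair_ne σ
  have hi : (Pi.single i 1 : σ → ℂ) ≠ 0 := by simp
  rw [← h.rank_eq _ hi]
  have hinj : Function.Injective ((evalVec (Pi.single i 1)).domRestrict (rangeSec A 0)) := by
    rw [← LinearMap.ker_eq_bot, LinearMap.ker_eq_bot']
    rintro ⟨w, hw⟩ h0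
    ext1
    ext1 p
    obtain ⟨z, hz⟩ := (hw.1 p).C_of_zero
    have := congrFun h0 p
    simp only [LinearMap.domRestrict_apply, evalVec_apply, hz, eval_C, Pi.zero_apply] at this
    simp [hz, this]
  rw [← LinearMap.finrank_range_of_inj hinj]
  refine two_mul_finrank_le_rank (h.map_eval_skew _) _ ?_
  rintro _ ⟨⟨w, hw⟩, rfl⟩ _ ⟨⟨w', hw'⟩, rfl⟩
  obtain ⟨N₁, hN₁⟩ := exists_pow_smul_eq_mulVec h.rank_eq hw.2
  obtain ⟨N₂, hN₂⟩ := exists_pow_smul_eq_mulVec h.rank_eq hw'.2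
  set N := N₁ + N₂
  have key : ∀ k, ∃ u ∈ formVec fun _ => (N : ℤ) - 1, (X k : MvPolynomial σ ℂ) ^ N • w' =
      A.mulVec u := by
    intro k
    obtain ⟨u, hu⟩ := hN₂ N (by omega) k
    have h1 := vecPart_mulVec (φ := A) (a := fun _ => -1) (b := fun _ => 0)
      (by simpa using h.linear) N u
    rw [← hu, vecPart_eq] at h1
    · refine ⟨_, ?_, h1⟩
      have h2 := vecPart_mem (fun _ : ι => -1 + (N : ℤ)) u
      rwa [neg_add_eq_sub] at h2
    · intro p
      have := (homog_X_pow k N).mul (hw'.1 p)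
      rwa [add_comm] at this
  obtain ⟨u₀, hu₀, e₀⟩ := key i
  obtain ⟨u₁, hu₁, e₁⟩ := key j
  obtain ⟨u', e'⟩ := hN₁ N (by omega) i
  -- A Čech argument: the value of the alternating form on (w, w') is (w · u₀)/Xᵢᴺ and also (w ·
  -- u₁)/Xⱼᴺ. As Xᵢ and Xⱼ are coprime, Xᵢᴺ divides w · u₀, which has degree N - 1 and so vanishes.
  have q₁ : X i ^ N * (w ⬝ᵥ u₁) = -(X j ^ N * (u' ⬝ᵥ w')) := by
    rw [← smul_eq_mul, ← smul_dotProduct, e', h.dotProduct_mulVec, ← e₁, dotProduct_smul,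
      smul_eq_mul]
  have q₀ : X i ^ N * (w ⬝ᵥ u₀) = -(X i ^ N * (u' ⬝ᵥ w')) := by
    rw [← smul_eq_mul, ← smul_dotProduct, e', h.dotProduct_mulVec, ← e₀, dotProduct_smul,
      smul_eq_mul]
  have q₀' : w ⬝ᵥ u₀ = -(u' ⬝ᵥ w') := by
    rw [← mul_neg] at q₀
    exact mul_left_cancel₀ (pow_ne_zero _ (X_ne_zero i)) q₀
  have hdvd : (X i : MvPolynomial σ ℂ) ^ N ∣ X j ^ N * (w ⬝ᵥ u₀) :=
    ⟨w ⬝ᵥ u₁, by rw [q₁, q₀', mul_neg]⟩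
  have hprime : Prime (X i : MvPolynomial σ ℂ) := X_prime
  have hdvd' := hprime.pow_dvd_of_dvd_mul_left N
    (fun hd => hij (X_dvd_X.1 (hprime.dvd_of_dvd_pow hd))) hdvd
  obtain ⟨q, hq⟩ := hdvd'
  have hhom : Homog (w ⬝ᵥ u₀) ((N : ℤ) - 1) := Homog.sum fun p _ => by
    have := (hw.1 p).mul (hu₀ p)
    rwa [zero_add] at this
  have hzero : w ⬝ᵥ u₀ = 0 := by
    rw [← hhom.formPart_eq, hq, (homog_X_pow i N).formPart_mul,
      (homog_formPart _ q).eq_zero (by omega), mul_zero]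
  refine ⟨evalVec (Pi.single i 1) u₀, ?_, ?_⟩
  · rw [← evalVec_mulVec, ← e₀, evalVec_smul]
    simp
  · have := congrArg (eval (Pi.single i 1)) hzero
    simpa [dotProduct] using this

end Skew

/-! ### Comparison of sections with their restrictions to a hyperplane -/

section Hyperplane

variable {ι : Type*} [Fintype ι] {k r : ℕ} {A : Matrix ι ι (MvPolynomial (Fin (k + 1)) ℂ)}

theorem IsSkewPencil.restrict (h : IsSkewPencil A r) :
    IsSkewPencil (A.map (PlaneBundle.restrict k)) r where
  linear i j := (h.linear i j).restrict
  skew := by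
    rw [← Matrix.transpose_map, h.skew]
    ext i j
    simp
  rank_eq v hv := by
    rw [map_restrict_map_eval]
    exact h.rank_eq _ (cons_zero_ne_zero hv)

/-- The image is saturated: x₀ can be divided out away from its zero locus, and membership then
extends by `InRange.of_generic`. -/
theorem IsSkewPencil.mem_rangeSec_of_mulX (h : IsSkewPencil A r) {t : ℤ}
    {w : ι → MvPolynomial (Fin (k + 1)) ℂ} (hw : w ∈ formVec fun _ => t)
    (hX : ∀ v, v ≠ 0 → InRange A (mulX k ι w) v) : w ∈ rangeSec A t := by
  refine ⟨hw, fun v hv => ?_⟩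
  refine InRange.of_generic h.rank_eq (X_ne_zero 0) (fun v hv hv0 => ?_) hv
  have h1 := hX v hv
  rw [InRange, mulX_apply, evalVec_smul] at h1
  exact (Submodule.smul_mem_iff _ hv0).1 h1

theorem IsSkewPencil.finrank_rangeSec_le (h : IsSkewPencil A r) (t : ℤ) :
    dimRange A t ≤
      dimRange (A.map (PlaneBundle.restrict k)) t +
        dimRange A (t - 1) := by
  refine finrank_le_add_of_map _ _ _ (restrictVec k ι) (mulX k ι) ?_ ?_
  · intro w hw
    refine ⟨fun i => (hw.1 i).restrict, fun v hv => ?_⟩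
    have := hw.2 _ (cons_zero_ne_zero hv)
    rwa [InRange, map_restrict_map_eval, evalVec_restrictVec]
  · intro w hw h0
    obtain ⟨w', hw', rfl⟩ := exists_eq_mulX hw.1 h0
    exact ⟨w', h.mem_rangeSec_of_mulX hw' hw.2, rfl⟩

theorem mem_kerSec_of_mulX {t : ℤ} {w : ι → MvPolynomial (Fin (k + 1)) ℂ}
    (hw : w ∈ formVec fun _ => t) (hX : A.mulVec (mulX k ι w) = 0) : w ∈ kerSec A t := by
  refine ⟨hw, ?_⟩
  rw [mulX_apply, Matrix.mulVec_smul] at hX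
  exact (smul_eq_zero.1 hX).resolve_left (X_ne_zero 0)

theorem finrank_kerSec_le (A : Matrix ι ι (MvPolynomial (Fin (k + 1)) ℂ)) (t : ℤ) :
    dimKer A t ≤
      dimKer (A.map (PlaneBundle.restrict k)) t +
        dimKer A (t - 1) := by
  refine finrank_le_add_of_map _ _ _ (restrictVec k ι) (mulX k ι) ?_ ?_
  · intro w hw
    refine ⟨fun i => (hw.1 i).restrict, ?_⟩
    ext1 i
    have := congrArg (PlaneBundle.restrict k) (congrFun hw.2 i)
    simpa [Matrix.mulVec, dotProduct] using this
  · intro w hw h0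
    obtain ⟨w', hw', rfl⟩ := exists_eq_mulX hw.1 h0
    exact ⟨w', mem_kerSec_of_mulX hw' hw.2, rfl⟩

end Hyperplane

/-! ### Estimates on a line and on the plane -/

/-- If a is the first degree with f a ≠ 0, then f grows by at most one per step until degree c - a
and by at most two afterwards. This mimics the section count of 𝒪(-a) ⊕ 𝒪(-max(a, c - a)) on a line.
-/
theorem le_max_of_increments {f : ℕ → ℕ} {c : ℕ} (h0 : f 0 ≤ 2) (h2 : ∀ i, f (i + 1) ≤ f i + 2)
    (h0' : f 0 ≠ 0 → 0 < c → f 0 ≤ 1)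
    (h1 : ∀ a i, f a ≠ 0 → a + (i + 1) < c → f (i + 1) ≤ f i + 1) (i : ℕ) :
    f i ≤ max (i + 1) (2 * i + 2 - c) := by
  by_cases hex : ∃ a, f a ≠ 0
  · classical
    have ha := Nat.find_spec hex
    set a := Nat.find hex
    have hmin : ∀ j, j < a → f j = 0 := fun j hj => by simpa using Nat.find_min hex hj
    have key : ∀ i, f i ≤ (i + 1 - a) + (i + 1 - max a (c - a)) := by
      intro i
      induction i with
      | zero =>
        rcases Nat.eq_zero_or_pos a with h | h
        · rcases Nat.eq_zero_or_pos c with hc | hc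
          · omega
          · have := h0' (h ▸ ha) hc
            omega
        · rw [hmin 0 h]; omega
      | succ i ih =>
        by_cases h : i + 1 < a
        · rw [hmin _ h]; omega
        · by_cases h' : a + (i + 1) < c
          · have := h1 a i ha h'
            omega
          · have := h2 i
            omega
    have := key i
    omega
  · push Not at hex
    rw [hex i]
    omega

section Line

variable {ι : Type*}

/-- The point of the line where the first coordinate vanishes. -/
abbrev basePoint : Fin 2 → ℂ := Fin.cons 0 1

theorem basePoint_ne_zero : basePoint ≠ 0 := cons_zero_ne_zero one_ne_zero

theorem exists_eq_mulX_of_evalVec {t : ℤ} {u : ι → MvPolynomial (Fin 2) ℂ}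
    (hu : u ∈ formVec fun _ => t) (h : evalVec basePoint u = 0) :
    ∃ w ∈ formVec fun _ => t - 1, mulX 1 ι w = u := by
  refine exists_eq_mulX hu ?_
  ext1 i
  refine (hu i).restrict.eq_zero_of_eval_one ?_
  rw [eval_restrict]
  exact congrFun h i

variable [Fintype ι] {r : ℕ} {A : Matrix ι ι (MvPolynomial (Fin 2) ℂ)}

theorem finrank_kerSec_le_of_eval {t : ℤ} (W : Submodule ℂ (ι → ℂ))
    (hW : ∀ u ∈ kerSec A t, evalVec basePoint u ∈ W) :
    dimKer A t ≤ Module.finrank ℂ W + dimKer A (t - 1) := by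
  refine finrank_le_add_of_map _ _ _ (evalVec basePoint) (mulX 1 ι) hW fun u hu h0 => ?_
  obtain ⟨w, hw, rfl⟩ := exists_eq_mulX_of_evalVec hu.1 h0
  exact ⟨w, mem_kerSec_of_mulX hw hu.2, rfl⟩

theorem IsSkewPencil.finrank_rangeSec_le_add (h : IsSkewPencil A r) (t : ℤ) :
    dimRange A t ≤ r + dimRange A (t - 1) := by
  rw [← h.rank_eq _ basePoint_ne_zero]
  refine finrank_le_add_of_map _ _ _ (evalVec basePoint) (mulX 1 ι)
    (fun u hu => hu.2 _ basePoint_ne_zero) fun u hu h0 => ?_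
  obtain ⟨w, hw, rfl⟩ := exists_eq_mulX_of_evalVec hu.1 h0
  exact ⟨w, h.mem_rangeSec_of_mulX hw hu.2, rfl⟩

theorem IsSkewPencil.finrank_kerSec_le_add_two (h : IsSkewPencil A r)
    (hr : Fintype.card ι = r + 2) (t : ℤ) :
    dimKer A t ≤ 2 + dimKer A (t - 1) := by
  have h1 := LinearMap.finrank_range_add_finrank_ker (A.map (eval basePoint)).mulVecLin
  have h2 := h.rank_eq _ basePoint_ne_zero
  rw [Matrix.rank] at h2
  rw [h2, Module.finrank_fintype_fun_eq_card, hr] at h1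
  have h3 : Module.finrank ℂ (LinearMap.ker (A.map (eval basePoint)).mulVecLin) = 2 := by omega
  refine (finrank_kerSec_le_of_eval _ fun u hu => ?_).trans_eq (congrArg (· + _) h3)
  rw [LinearMap.mem_ker, Matrix.mulVecLin_apply, ← evalVec_mulVec, hu.2, map_zero]

/-- Two independent sections of the kernel have large total degree. -/
theorem IsSkewPencil.le_add_of_minor_ne_zero (h : IsSkewPencil A r) (hr : Fintype.card ι = r + 2)
    {a b : ℕ} {u₁ u₂ : ι → MvPolynomial (Fin 2) ℂ} (h₁ : u₁ ∈ kerSec A a) (h₂ : u₂ ∈ kerSec A b)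
    {i j : ι} (hij : u₁ i * u₂ j - u₁ j * u₂ i ≠ 0) : r ≤ 2 * (a + b) := by
  classical
  have hV : Module.finrank ℂ (formVec fun _ : ι => (0 : ℤ) : Submodule ℂ (ι → MvPolynomial (Fin 2) ℂ))
      = r + 2 := by
    rw [finrank_formVec]
    have := finrank_forms_two (d := 0) (by norm_num)
    norm_cast at this
    simp [this, hr]
  have hT : Module.finrank ℂ (formVec ![(a : ℤ), b] :
      Submodule ℂ (Fin 2 → MvPolynomial (Fin 2) ℂ)) = (a + 1) + (b + 1) := by
    rw [finrank_formVec]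
    have h1 := finrank_forms_two (d := a) (by omega)
    have h2 := finrank_forms_two (d := b) (by omega)
    norm_cast at h1 h2
    rw [Fin.sum_univ_two]
    exact congrArg₂ (· + ·) h1 h2
  have h0 := h.two_mul_finrank_rangeSec_zero_le
  let f : (ι → MvPolynomial (Fin 2) ℂ) →ₗ[ℂ] (Fin 2 → MvPolynomial (Fin 2) ℂ) :=
    (Matrix.of ![u₁, u₂]).mulVecLin.restrictScalars ℂ
  have hf0 : ∀ w, f w 0 = u₁ ⬝ᵥ w := fun w => rfl
  have hf1 : ∀ w, f w 1 = u₂ ⬝ᵥ w := fun w => rfl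
  -- Pairing with `u₁`, `u₂` sends the r + 2 dimensions of constant vectors to forms of degrees a
  -- and b, of total dimension a + b + 2. The kernel consists of constant sections of the image, so
  -- its dimension is at most r/2.
  have := finrank_le_add_of_map (formVec fun _ : ι => (0 : ℤ)) (formVec ![(a : ℤ), b])
    (rangeSec A 0) f LinearMap.id ?_ ?_
  · rw [hV, hT] at this
    rw [dimRange] at h0
    omega
  · intro w hw p
    fin_cases p
    · change Homog (u₁ ⬝ᵥ w) a
      refine Homog.sum fun p _ => ?_
      simpa using (h₁.1 p).mul (hw p)
    · change Homog (u₂ ⬝ᵥ w) b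
      refine Homog.sum fun p _ => ?_
      simpa using (h₂.1 p).mul (hw p)
  · intro w hw hfw
    refine ⟨w, ⟨hw, fun v hv => ?_⟩, rfl⟩
    refine InRange.of_generic h.rank_eq hij (fun v hv hvij => ?_) hv
    have e1 := congrArg (evalVec v) h₁.2
    have e2 := congrArg (evalVec v) h₂.2
    rw [evalVec_mulVec, map_zero] at e1 e2
    refine mem_range_of_dotProduct_eq_zero (h.map_eval_skew v) (by rw [h.rank_eq v hv, hr]) e1 e2
      (i := i) (j := j) (by simpa using hvij) ?_ ?_
    · have := congrArg (eval v) ((hf0 w).symm.trans (congrFun hfw 0))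
      simpa [dotProduct] using this
    · have := congrArg (eval v) ((hf1 w).symm.trans (congrFun hfw 1))
      simpa [dotProduct] using this

/-- Below the threshold a + b < r/2 every section of degree b is proportional to a fixed nonzero
section of degree a, so the values at the base point span at most a line instead of the whole
two-dimensional kernel. -/
theorem IsSkewPencil.finrank_kerSec_le_add_one (h : IsSkewPencil A r)
    (hr : Fintype.card ι = r + 2) {a b : ℕ} (ha : dimKer A a ≠ 0)
    (hab : 2 * (a + b) < r) :
    dimKer A b ≤ 1 + dimKer A ((b : ℤ) - 1) := by
  obtain ⟨u, hu, hu0⟩ := (Submodule.ne_bot_iff _).1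
    (fun hb : kerSec A a = ⊥ => ha (by rw [dimKer, hb, finrank_bot]))
  obtain ⟨p, hp⟩ := Function.ne_iff.1 hu0
  have hminor : ∀ u' ∈ kerSec A b, ∀ q, u p * u' q = u q * u' p := by
    intro u' hu' q
    by_contra hc
    have := h.le_add_of_minor_ne_zero hr hu hu' (i := p) (j := q) (sub_ne_zero.2 hc)
    omega
  -- Proportionality to `u` passes to pairs of sections after multiplication by the nonzero square
  -- (u p)².
  have hminor' : ∀ u₁ ∈ kerSec A b, ∀ u₂ ∈ kerSec A b, ∀ q s, u₁ q * u₂ s = u₁ s * u₂ q := by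
    intro u₁ h₁ u₂ h₂ q s
    refine mul_left_cancel₀ (mul_ne_zero hp hp) ?_
    calc u p * u p * (u₁ q * u₂ s) = (u p * u₁ q) * (u p * u₂ s) := by ring
      _ = (u p * u₁ s) * (u p * u₂ q) := by
        rw [hminor _ h₁, hminor _ h₂, hminor _ h₁, hminor _ h₂]; ring
      _ = _ := by ring
  have hle : Module.finrank ℂ ((kerSec A b).map (evalVec basePoint)) ≤ 1 := by
    by_cases hz : ∃ u₁ ∈ kerSec A b, evalVec basePoint u₁ ≠ 0
    · obtain ⟨u₁, h₁, hne⟩ := hz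
      obtain ⟨q, hq⟩ := Function.ne_iff.1 hne
      refine finrank_le_one ⟨evalVec basePoint u₁, Submodule.mem_map_of_mem h₁⟩ ?_
      rintro ⟨_, u₂, h₂, rfl⟩
      refine ⟨eval basePoint (u₂ q) / eval basePoint (u₁ q), ?_⟩
      ext s
      have := congrArg (eval basePoint) (hminor' _ h₁ _ h₂ q s)
      simp only [map_mul] at this
      have hq' : eval basePoint (u₁ q) ≠ 0 := hq
      simp only [SetLike.mk_smul_mk, Pi.smul_apply, evalVec_apply, smul_eq_mul]
      rw [div_mul_eq_mul_div, div_eq_iff hq', mul_comm, ← this, mul_comm]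
    · push Not at hz
      have : (kerSec A b).map (evalVec basePoint) = ⊥ := by
        rw [Submodule.eq_bot_iff]
        rintro _ ⟨u', hu', rfl⟩
        exact hz u' hu'
      rw [this, finrank_bot]
      exact zero_le_one
  refine (finrank_kerSec_le_of_eval _ fun u hu => Submodule.mem_map_of_mem hu).trans ?_
  omega

theorem formVec_eq_bot {σ ι : Type*} {t : ℤ} (ht : t < 0) :
    (formVec fun _ : ι => t : Submodule ℂ (ι → MvPolynomial σ ℂ)) = ⊥ :=
  (Submodule.eq_bot_iff _).2 fun _ hu => funext fun i => (hu i).eq_zero ht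

theorem finrank_kerSec_of_neg {σ : Type*} (A : Matrix ι ι (MvPolynomial σ ℂ)) {t : ℤ}
    (ht : t < 0) : dimKer A t = 0 := by
  rw [dimKer]
  have : kerSec A t = ⊥ := by
    rw [← le_bot_iff, ← formVec_eq_bot ht]
    exact fun _ h => h.1
  rw [this, finrank_bot]

theorem IsSkewPencil.finrank_kerSec_le_max {c : ℕ} (h : IsSkewPencil A (2 * c))
    (hr : Fintype.card ι = 2 * c + 2) (t : ℕ) :
    dimKer A t ≤ max (t + 1) (2 * t + 2 - c) := by
  have hneg := finrank_kerSec_of_neg A (t := -1) (by norm_num)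
  refine le_max_of_increments (f := fun t => dimKer A (t : ℤ)) ?_ ?_ ?_ ?_ t
  · have := h.finrank_kerSec_le_add_two hr 0
    simpa [hneg] using this
  · intro i
    have := h.finrank_kerSec_le_add_two hr (i + 1)
    simp only [add_sub_cancel_right] at this
    push_cast
    omega
  · intro h0 hc
    have := h.finrank_kerSec_le_add_one hr (a := 0) (b := 0) h0 (by omega)
    simpa [hneg] using this
  · intro a i ha hi
    have := h.finrank_kerSec_le_add_one hr (a := a) (b := i + 1) ha (by omega)
    push_cast at this ⊢
    simp only [add_sub_cancel_right] at this
    omega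

theorem IsSkewPencil.finrank_rangeSec_le_line {c : ℕ} (h : IsSkewPencil A (2 * c)) (t : ℕ) :
    dimRange A t ≤ c + 2 * c * t := by
  induction t with
  | zero =>
    have := h.two_mul_finrank_rangeSec_zero_le
    simp only [Nat.cast_zero]
    omega
  | succ t ih =>
    have := h.finrank_rangeSec_le_add (t + 1)
    simp only [add_sub_cancel_right] at this
    push_cast
    linarith

end Line

/-! ### Summation over degrees: from a line to the plane -/

section Plane

variable {ι : Type*} [Fintype ι] {c : ℕ} {A : Matrix ι ι (MvPolynomial (Fin 3) ℂ)}

/-- The line bounds c + 2cs, summed over s ≤ t, give c(t + 1)². -/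
theorem IsSkewPencil.finrank_rangeSec_le_plane (h : IsSkewPencil A (2 * c)) (t : ℕ) :
    dimRange A t ≤ c * (t + 1) ^ 2 := by
  induction t with
  | zero =>
    have := h.two_mul_finrank_rangeSec_zero_le
    simp only [Nat.cast_zero]
    omega
  | succ t ih =>
    have h1 := h.finrank_rangeSec_le (t + 1)
    have h2 := h.restrict.finrank_rangeSec_le_line (t + 1)
    simp only [add_sub_cancel_right] at h1
    push_cast at h2 ⊢
    nlinarith

theorem IsSkewPencil.finrank_kerSec_le_plane_of_lt (h : IsSkewPencil A (2 * c))
    (hr : Fintype.card ι = 2 * c + 2) (t : ℕ) (ht : t < c) :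
    2 * dimKer A t ≤ (t + 1) * (t + 2) := by
  induction t with
  | zero =>
    have h1 := finrank_kerSec_le A 0
    have h2 := h.restrict.finrank_kerSec_le_max hr 0
    have h3 := finrank_kerSec_of_neg A (t := -1) (by norm_num)
    simp only [zero_sub, h3, Nat.cast_zero] at *
    omega
  | succ t ih =>
    have h1 := finrank_kerSec_le A (t + 1)
    have h2 := h.restrict.finrank_kerSec_le_max hr (t + 1)
    have h3 := ih (by omega)
    simp only [add_sub_cancel_right] at h1
    push_cast at h2 ⊢
    rw [max_eq_left (by omega)] at h2
    nlinarith

/-- From degree c - 1 on, the second term of the maximum on the line governs the increments. The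
right-hand side is twice the value that the Hilbert polynomial gives when y = 0. -/
theorem IsSkewPencil.finrank_kerSec_le_plane (h : IsSkewPencil A (2 * c)) (hc : 0 < c)
    (hr : Fintype.card ι = 2 * c + 2) (j : ℕ) :
    2 * dimKer A ((c - 1 + j : ℕ) : ℤ) ≤ c * (c + 1) + 2 * j * (c + 1 + j) := by
  induction j with
  | zero =>
    have := h.finrank_kerSec_le_plane_of_lt hr (c - 1) (by omega)
    obtain ⟨d, rfl⟩ : ∃ d, c = d + 1 := ⟨c - 1, by omega⟩
    simp only [Nat.add_sub_cancel, add_zero] at *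
    linarith
  | succ j ih =>
    have h1 := finrank_kerSec_le A ((c - 1 + (j + 1) : ℕ) : ℤ)
    have h2 := h.restrict.finrank_kerSec_le_max hr (c - 1 + (j + 1))
    have h3 : ((c - 1 + (j + 1) : ℕ) : ℤ) - 1 = ((c - 1 + j : ℕ) : ℤ) := by push_cast; ring
    rw [h3] at h1
    rw [max_eq_right (by omega)] at h2
    have h4 : 2 * (c - 1 + (j + 1)) + 2 - c = c + 2 * j + 2 := by omega
    rw [h4] at h2
    nlinarith

end Plane

/-! ### The Chow ring -/

section ChowRing

theorem lineClass_pow_three : lineClass ^ 3 = 0 := by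
  have := AdjoinRoot.eval₂_root (Polynomial.X ^ 3 : Polynomial ℤ)
  rwa [Polynomial.eval₂_X_pow] at this

theorem chow_eq_zero {a b c : ℤ}
    (h : (a : Chow) + (b : Chow) * lineClass + (c : Chow) * lineClass ^ 2 = 0) :
    a = 0 ∧ b = 0 ∧ c = 0 := by
  have h1 : AdjoinRoot.mk (Polynomial.X ^ 3 : Polynomial ℤ)
      (Polynomial.C a + Polynomial.C b * Polynomial.X + Polynomial.C c * Polynomial.X ^ 2) = 0 := by
    rw [map_add, map_add, map_mul, map_mul, map_pow, AdjoinRoot.mk_X, eq_intCast, eq_intCast,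
      eq_intCast, map_intCast, map_intCast, map_intCast]
    exact h
  rw [AdjoinRoot.mk_eq_zero, Polynomial.X_pow_dvd_iff] at h1
  have h0' := h1 0 (by norm_num)
  have h1' := h1 1 (by norm_num)
  have h2' := h1 2 (by norm_num)
  simp only [Polynomial.coeff_add, Polynomial.coeff_C_mul, Polynomial.coeff_X,
    Polynomial.coeff_X_pow, Polynomial.coeff_C] at h0' h1' h2'
  norm_num at h0' h1' h2'
  exact ⟨h0', h1', h2'⟩

/-- `x` is a total Chern class whose Chern roots have sum `p` and sum of squares `q`. -/
def HasPowerSums (x : Chow) (p q : ℤ) : Prop :=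
  ∃ e : ℤ, 2 * e = p ^ 2 - q ∧ x = 1 + (p : Chow) * lineClass + (e : Chow) * lineClass ^ 2

theorem HasPowerSums.mul {x x' : Chow} {p q p' q' : ℤ} (h : HasPowerSums x p q)
    (h' : HasPowerSums x' p' q') : HasPowerSums (x * x') (p + p') (q + q') := by
  obtain ⟨e, he, rfl⟩ := h
  obtain ⟨e', he', rfl⟩ := h'
  refine ⟨e + e' + p * p', by linarith, ?_⟩
  push_cast
  linear_combination ((p : Chow) * e' + e * p' + e * e' * lineClass) * lineClass_pow_three

theorem hasPowerSums_prod {ι : Type*} (s : Finset ι) {x : ι → Chow} {p q : ι → ℤ}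
    (h : ∀ i ∈ s, HasPowerSums (x i) (p i) (q i)) :
    HasPowerSums (∏ i ∈ s, x i) (∑ i ∈ s, p i) (∑ i ∈ s, q i) := by
  classical
  induction s using Finset.induction_on with
  | empty => exact ⟨0, by simp, by simp⟩
  | insert a s ha ih =>
    rw [Finset.prod_insert ha, Finset.sum_insert ha, Finset.sum_insert ha]
    exact (h a (by simp)).mul (ih fun i hi => h i (by simp [hi]))

theorem HasPowerSums.unique {x : Chow} {p q p' q' : ℤ} (h : HasPowerSums x p q)
    (h' : HasPowerSums x p' q') : p = p' ∧ q = q' := by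
  obtain ⟨e, he, rfl⟩ := h
  obtain ⟨e', he', h⟩ := h'
  obtain ⟨-, h1, h2⟩ := chow_eq_zero (a := 0) (b := p - p') (c := e - e') (by
    push_cast
    linear_combination h)
  obtain rfl : p = p' := by linarith
  exact ⟨rfl, by linarith⟩

/-- The `k`-th power sum of the Chern roots of a sum of line bundles. -/
def SplitBundle.powerSum (F : SplitBundle) (k : ℕ) : ℤ := ∑ j, F.twist j ^ k

theorem SplitBundle.hasPowerSums (F : SplitBundle) :
    HasPowerSums F.totalChern (F.powerSum 1) (F.powerSum 2) := by
  refine hasPowerSums_prod _ fun i _ => ⟨0, by ring, ?_⟩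
  rw [pow_one]
  push_cast
  ring

theorem sum_filter_even_sub_odd (n : ℕ) (f : ℕ → ℤ) :
    ∑ i ∈ (Finset.range n).filter (fun i => Even i), f i -
      ∑ i ∈ (Finset.range n).filter (fun i => Odd i), f i =
    ∑ i ∈ Finset.range n, (-1) ^ i * f i := by
  rw [Finset.sum_filter, Finset.sum_filter, ← Finset.sum_sub_distrib]
  refine Finset.sum_congr rfl fun i _ => ?_
  rcases Nat.even_or_odd i with h | h
  · rw [if_pos h, if_neg (Nat.not_odd_iff_even.2 h), h.neg_one_pow]; ring
  · rw [if_pos h, if_neg (Nat.not_even_iff_odd.2 h), h.neg_one_pow]; ring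

/-- Products of total Chern classes add power sums of Chern roots, and the power sums determine and
are determined by the class modulo h³. So the Whitney formula becomes two alternating sums. -/
theorem powerSums_eq_of_prod_eq {L : ℕ → SplitBundle} {n : ℕ} {a b : ℤ}
    (h : (1 + (a : Chow) * lineClass + (b : Chow) * lineClass ^ 2) *
        ∏ i ∈ (Finset.range n).filter (fun i => Odd i), (L i).totalChern =
      ∏ i ∈ (Finset.range n).filter (fun i => Even i), (L i).totalChern) :
    ∑ i ∈ Finset.range n, (-1) ^ i * (L i).powerSum 1 = a ∧
      ∑ i ∈ Finset.range n, (-1) ^ i * (L i).powerSum 2 = a ^ 2 - 2 * b := by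
  have h1 : HasPowerSums (1 + (a : Chow) * lineClass + (b : Chow) * lineClass ^ 2) a
      (a ^ 2 - 2 * b) := ⟨b, by ring, rfl⟩
  have h2 := h1.mul (hasPowerSums_prod ((Finset.range n).filter (fun i => Odd i))
    fun i _ => (L i).hasPowerSums)
  rw [h] at h2
  obtain ⟨h3, h4⟩ := h2.unique (hasPowerSums_prod _ fun i _ => (L i).hasPowerSums)
  rw [← sum_filter_even_sub_odd, ← sum_filter_even_sub_odd]
  exact ⟨by linarith, by linarith⟩

end ChowRing

/-! ### The Hilbert polynomial of a resolved bundle -/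

theorem finrank_eq_map_add {E F : Type*} [AddCommGroup E] [Module ℂ E] [AddCommGroup F]
    [Module ℂ F] {W K : Submodule ℂ E} [FiniteDimensional ℂ W] {f : E →ₗ[ℂ] F}
    (hK : ∀ x, x ∈ K ↔ x ∈ W ∧ f x = 0) :
    Module.finrank ℂ W = Module.finrank ℂ (W.map f) + Module.finrank ℂ K := by
  rw [← LinearMap.finrank_range_add_finrank_ker (f.domRestrict W), LinearMap.range_domRestrict,
    LinearMap.ker_domRestrict]
  congr 1
  have hKW : K ≤ W := fun x hx => ((hK x).1 hx).1
  rw [← (Submodule.comapSubtypeEquivOfLe hKW).finrank_eq]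
  have : Submodule.comap W.subtype (LinearMap.ker f) = Submodule.comap W.subtype K := by
    ext ⟨x, hx⟩
    simp [hK, hx]
  rw [this]

theorem sum_neg_one_pow_of_telescope {h r : ℕ → ℤ} {e : ℤ} (h0 : h 0 = r 0 + e)
    {n : ℕ} (hs : ∀ i, i < n → h (i + 1) = r i + r (i + 1)) :
    ∑ i ∈ Finset.range (n + 1), (-1) ^ i * h i = e + (-1) ^ n * r n := by
  induction n with
  | zero => simp [h0]; ring
  | succ n ih =>
    rw [Finset.sum_range_succ, ih fun i hi => hs i (by omega), hs n (by omega)]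
    ring

section Resolution

theorem inRange_mulVec {σ ι κ : Type*} [Fintype κ] (φ : Matrix ι κ (MvPolynomial σ ℂ))
    (u : κ → MvPolynomial σ ℂ) (v : σ → ℂ) : InRange φ (φ.mulVec u) v :=
  ⟨evalVec v u, by rw [evalVec_mulVec, Matrix.mulVecLin_apply]⟩

/-- The global sections of `F(t)`. -/
abbrev SplitBundle.sections (F : SplitBundle) (t : ℤ) : Submodule ℂ (Fin F.rank → Coord) :=
  formVec fun j => F.twist j + t

/-- Summing (d + t + 1)(d + t + 2) over the twists d shows that the Hilbert polynomial is linear in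
the rank and the first two power sums. -/
theorem SplitBundle.two_mul_finrank_sections (F : SplitBundle) :
    ∃ D : ℤ, ∀ t, D ≤ t → 2 * (Module.finrank ℂ (F.sections t) : ℤ) =
      (t + 1) * (t + 2) * F.rank + (2 * t + 3) * F.powerSum 1 + F.powerSum 2 := by
  refine ⟨∑ j, |F.twist j|, fun t ht => ?_⟩
  have h0 : (F.rank : ℤ) = ∑ _j : Fin F.rank, (1 : ℤ) := by simp
  rw [finrank_formVec, Nat.cast_sum, Finset.mul_sum, h0, SplitBundle.powerSum, SplitBundle.powerSum,
    Finset.mul_sum, Finset.mul_sum, ← Finset.sum_add_distrib, ← Finset.sum_add_distrib]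
  refine Finset.sum_congr rfl fun j _ => ?_
  have h1 : |F.twist j| ≤ ∑ j, |F.twist j| :=
    Finset.single_le_sum (f := fun j => |F.twist j|) (fun _ _ => abs_nonneg _) (Finset.mem_univ j)
  have h2 := neg_abs_le (F.twist j)
  rw [two_mul_finrank_forms_three (by linarith)]
  ring

variable {n r : ℕ} {A : Matrix (Fin n) (Fin n) Coord} {hA : ∀ i j, (A i j).IsHomogeneous 1}

/-- The rank of the `i`-th differential of a resolution. -/
def Resolution.differentialRank (R : Resolution (linearHom A hA)) : ℕ → ℕ
  | 0 => (R.L 0).rank - 2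
  | i + 1 => (R.L (i + 1)).rank - R.differentialRank i

theorem Resolution.rank_zero_eq (R : Resolution (linearHom A hA)) (h : IsSkewPencil A r)
    (hn : n = r + 2) {v : Fin 3 → ℂ} (hv : v ≠ 0) :
    (R.L 0).rank = ((R.d 0).mat.map (eval v)).rank + 2 := by
  have h1 := LinearMap.finrank_range_add_finrank_ker
    ((LinearMap.range ((linearHom A hA).fibre v)).mkQ ∘ₗ R.aug.fibre v)
  rw [LinearMap.range_eq_top.2 (R.surjective_aug v hv), finrank_top,
    (R.exact_aug v hv).linearMap_ker_eq, Module.finrank_fintype_fun_eq_card, Fintype.card_fin] at h1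
  have h2 := Submodule.finrank_quotient_add_finrank (LinearMap.range ((linearHom A hA).fibre v))
  rw [Module.finrank_fintype_fun_eq_card, Fintype.card_fin] at h2
  have h3 : Module.finrank ℂ (LinearMap.range ((linearHom A hA).fibre v)) = r := h.rank_eq v hv
  have h4 : (copies n 0).rank = n := rfl
  change _ + ((R.d 0).mat.map (eval v)).rank = _ at h1
  omega

theorem Resolution.rank_succ_eq (R : Resolution (linearHom A hA)) (i : ℕ) {v : Fin 3 → ℂ}
    (hv : v ≠ 0) : (R.L (i + 1)).rank =
      ((R.d i).mat.map (eval v)).rank + ((R.d (i + 1)).mat.map (eval v)).rank := by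
  have h1 := LinearMap.finrank_range_add_finrank_ker ((R.d i).fibre v)
  rw [(R.exact v hv i).linearMap_ker_eq, Module.finrank_fintype_fun_eq_card, Fintype.card_fin] at h1
  exact h1.symm

theorem Resolution.rank_differential (R : Resolution (linearHom A hA)) (h : IsSkewPencil A r)
    (hn : n = r + 2) (i : ℕ) {v : Fin 3 → ℂ} (hv : v ≠ 0) :
    ((R.d i).mat.map (eval v)).rank = R.differentialRank i := by
  induction i with
  | zero =>
    have := R.rank_zero_eq h hn hv
    rw [Resolution.differentialRank]
    omega
  | succ i ih =>
    have := R.rank_succ_eq i hv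
    rw [Resolution.differentialRank]
    omega

theorem Resolution.sum_rank (R : Resolution (linearHom A hA)) (h : IsSkewPencil A r)
    (hn : n = r + 2) :
    ∑ i ∈ Finset.range (R.length + 1), (-1) ^ i * ((R.L i).rank : ℤ) = 2 := by
  have hv : (1 : Fin 3 → ℂ) ≠ 0 := one_ne_zero
  rw [sum_neg_one_pow_of_telescope (r := fun i => (((R.d i).mat.map (eval 1)).rank : ℤ)) (e := 2)]
  · have h1 := Matrix.rank_le_card_width ((R.d R.length).mat.map (eval 1))
    have h2 := R.rank_eq_zero (R.length + 1) (Nat.lt_succ_self _)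
    rw [Fintype.card_fin] at h1
    have h3 : ((R.d R.length).mat.map (eval 1)).rank = 0 := by omega
    rw [h3]
    simp
  · exact_mod_cast R.rank_zero_eq h hn hv
  · exact fun i _ => by exact_mod_cast R.rank_succ_eq i hv

theorem Resolution.mulVec_mulVec (R : Resolution (linearHom A hA)) (i : ℕ)
    (u : Fin (R.L (i + 2)).rank → Coord) :
    (R.d i).mat.mulVec ((R.d (i + 1)).mat.mulVec u) = 0 := by
  refine ext_of_evalVec (X 0) (X_ne_zero 0) fun v hv => ?_
  have hv0 : v ≠ 0 := by rintro rfl; simp at hv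
  rw [evalVec_mulVec, evalVec_mulVec, map_zero]
  exact (R.exact v hv0 i).apply_apply_eq_zero _

theorem Resolution.exists_sections_exact (R : Resolution (linearHom A hA)) (h : IsSkewPencil A r)
    (hn : n = r + 2) (i : ℕ) :
    ∃ D : ℤ, ∀ t, D ≤ t → ∀ s ∈ (R.L (i + 1)).sections t, (R.d i).mat.mulVec s = 0 →
      ∃ u ∈ (R.L (i + 2)).sections t, (R.d (i + 1)).mat.mulVec u = s := by
  obtain ⟨D, hD⟩ := exists_forall_exists_mulVec_eq (φ := (R.d (i + 1)).mat)
    (a := (R.L (i + 2)).twist) (b := (R.L (i + 1)).twist) (R.d (i + 1)).isForm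
    (fun v hv => R.rank_differential h hn (i + 1) hv)
  refine ⟨D, fun t ht s hs hs0 => hD t ht s hs fun v hv => ?_⟩
  have h1 := congrArg (evalVec v) hs0
  rw [evalVec_mulVec, map_zero] at h1
  exact (R.exact v hv i _).1 h1

theorem Resolution.exists_sections_exact_aug (R : Resolution (linearHom A hA))
    (h : IsSkewPencil A r) (hn : n = r + 2) :
    ∃ D : ℤ, ∀ t, D ≤ t → ∀ s ∈ (R.L 0).sections t, R.aug.mat.mulVec s ∈ rangeSec A t →
      ∃ u ∈ (R.L 1).sections t, (R.d 0).mat.mulVec u = s := by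
  obtain ⟨D, hD⟩ := exists_forall_exists_mulVec_eq (φ := (R.d 0).mat)
    (a := (R.L 1).twist) (b := (R.L 0).twist) (R.d 0).isForm
    (fun v hv => R.rank_differential h hn 0 hv)
  refine ⟨D, fun t ht s hs hs0 => hD t ht s hs fun v hv => ?_⟩
  refine (R.exact_aug v hv _).1 ?_
  rw [LinearMap.comp_apply, Submodule.mkQ_apply, Submodule.Quotient.mk_eq_zero]
  have h1 := hs0.2 v hv
  rw [InRange, evalVec_mulVec] at h1
  exact h1

/-- Surjectivity onto the cokernel means that `R.aug` and `A` placed side by side have full rank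
everywhere; the lifting theorem applies to this block matrix, and its `A`-part contributes a section
of the image. -/
theorem Resolution.exists_sections_surjective (R : Resolution (linearHom A hA)) :
    ∃ D : ℤ, ∀ t, D ≤ t → ∀ w ∈ (formVec fun _ => t : Submodule ℂ (Fin n → Coord)),
      ∃ s ∈ (R.L 0).sections t, w - R.aug.mat.mulVec s ∈ rangeSec A t := by
  have hsurj : ∀ v : Fin 3 → ℂ, v ≠ 0 → ∀ w : Fin n → ℂ,
      ∃ u, ((Matrix.fromCols R.aug.mat A).map (eval v)).mulVec u = w := by
    intro v hv w
    obtain ⟨s, hs⟩ := R.surjective_aug v hv (Submodule.Quotient.mk w)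
    rw [LinearMap.comp_apply, Submodule.mkQ_apply, eq_comm, Submodule.Quotient.eq] at hs
    obtain ⟨a, ha⟩ := hs
    refine ⟨Sum.elim s a, ?_⟩
    have : (Matrix.fromCols R.aug.mat A).map (eval v) =
        Matrix.fromCols (R.aug.mat.map (eval v)) (A.map (eval v)) := by
      ext i (j | j) <;> rfl
    rw [this, Matrix.fromCols_mulVec]
    have ha' : (A.map (eval v)).mulVec a = w - (R.aug.mat.map (eval v)).mulVec s := ha
    simp only [Sum.elim_comp_inl, Sum.elim_comp_inr]
    rw [ha']
    exact add_sub_cancel _ _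
  obtain ⟨D, hD⟩ := exists_forall_exists_mulVec_eq (φ := Matrix.fromCols R.aug.mat A)
    (a := Sum.elim (R.L 0).twist fun _ => -1) (b := fun _ => 0) (r := n)
    (by
      rintro i (j | j)
      · exact R.aug.isForm i j
      · exact (linearHom A hA).isForm i j)
    (by
      intro v hv
      rw [Matrix.rank, LinearMap.range_eq_top.2 (show Function.Surjective (Matrix.mulVecLin _) from
        hsurj v hv), finrank_top, Module.finrank_fintype_fun_eq_card]
      simp)
  refine ⟨D, fun t ht w hw => ?_⟩
  obtain ⟨u, hu, hw'⟩ := hD t ht w (by simpa using hw) fun v hv => hsurj v hv _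
  rw [Matrix.fromCols_mulVec] at hw'
  have e1 : w - R.aug.mat.mulVec (u ∘ Sum.inl) = A.mulVec (u ∘ Sum.inr) := by
    rw [← hw']; exact add_sub_cancel_left _ _
  refine ⟨u ∘ Sum.inl, fun j => hu (Sum.inl j), ?_⟩
  rw [e1]
  refine ⟨?_, fun v hv => inRange_mulVec _ _ _⟩
  have := mulVec_mem_formVec (φ := A) (a := fun _ => -1) (b := fun _ => 0)
    (fun i j => (linearHom A hA).isForm i j) (t := t) (u := u ∘ Sum.inr) fun j => hu (Sum.inr j)
  simpa using this

/-- In high degree the complex of sections is exact, so its Euler characteristic telescopes to the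
dimension of the quotient of the vectors of forms of degree t by `rangeSec A t`. -/
theorem Resolution.sum_finrank_sections (R : Resolution (linearHom A hA)) (h : IsSkewPencil A r)
    (hn : n = r + 2) : ∃ D : ℤ, ∀ t, D ≤ t →
      ∑ i ∈ Finset.range (R.length + 1), (-1) ^ i * (Module.finrank ℂ ((R.L i).sections t) : ℤ) =
        n * Module.finrank ℂ (forms (Fin 3) t) - dimRange A t := by
  choose D₁ hD₁ using R.exists_sections_exact h hn
  obtain ⟨D₂, hD₂⟩ := R.exists_sections_exact_aug h hn
  obtain ⟨D₃, hD₃⟩ := R.exists_sections_surjective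
  refine ⟨∑ i ∈ Finset.range R.length, |D₁ i| + |D₂| + |D₃|, fun t ht => ?_⟩
  have hs : 0 ≤ ∑ i ∈ Finset.range R.length, |D₁ i| := Finset.sum_nonneg fun _ _ => abs_nonneg _
  have ht₂ : D₂ ≤ t := by linarith [le_abs_self D₂, abs_nonneg D₃]
  have ht₃ : D₃ ≤ t := by linarith [le_abs_self D₃, abs_nonneg D₂]
  have ht₁ : ∀ i, i < R.length → D₁ i ≤ t := fun i hi => by
    have := Finset.single_le_sum (f := fun i => |D₁ i|) (fun _ _ => abs_nonneg _)
      (Finset.mem_range.2 hi)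
    linarith [le_abs_self (D₁ i), abs_nonneg D₂, abs_nonneg D₃]
  let δ : ∀ i, (Fin (R.L (i + 1)).rank → Coord) →ₗ[ℂ] (Fin (R.L i).rank → Coord) := fun i =>
    (R.d i).mat.mulVecLin.restrictScalars ℂ
  let I : ∀ i, Submodule ℂ (Fin (R.L i).rank → Coord) := fun i =>
    ((R.L (i + 1)).sections t).map (δ i)
  have hδ : ∀ i, ∀ u ∈ (R.L (i + 1)).sections t, δ i u ∈ (R.L i).sections t := fun i u hu =>
    mulVec_mem_formVec (R.d i).isForm hu
  let α : (Fin (R.L 0).rank → Coord) →ₗ[ℂ] (Fin n → Coord) :=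
    R.aug.mat.mulVecLin.restrictScalars ℂ
  have hα : ∀ s ∈ (R.L 0).sections t, α s ∈ (formVec fun _ => t : Submodule ℂ (Fin n → Coord)) := by
    intro s hs
    have := mulVec_mem_formVec R.aug.isForm hs
    simp only [zero_add] at this
    exact this
  have hαδ : ∀ u ∈ (R.L 1).sections t, α (δ 0 u) ∈ rangeSec A t := fun u hu =>
    ⟨hα _ (hδ 0 u hu), fun v hv => by
      have h1 := (R.exact_aug v hv).apply_apply_eq_zero (evalVec v u)
      rw [LinearMap.comp_apply, Submodule.mkQ_apply, Submodule.Quotient.mk_eq_zero] at h1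
      have h2 : evalVec v (α (δ 0 u)) = R.aug.fibre v ((R.d 0).fibre v (evalVec v u)) :=
        (evalVec_mulVec v R.aug.mat _).trans (congrArg _ (evalVec_mulVec v (R.d 0).mat u))
      rw [InRange, h2]
      exact h1⟩
  have hV := finrank_eq_map_add (W := (formVec fun _ => t : Submodule ℂ (Fin n → Coord)))
    (K := rangeSec A t) (f := (rangeSec A t).mkQ) fun x => by
      rw [Submodule.mkQ_apply, Submodule.Quotient.mk_eq_zero]
      exact ⟨fun hx => ⟨hx.1, hx⟩, fun hx => hx.2⟩
  have h0 := finrank_eq_map_add (W := (R.L 0).sections t) (K := I 0)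
    (f := (rangeSec A t).mkQ ∘ₗ α) fun x => by
      rw [LinearMap.comp_apply, Submodule.mkQ_apply, Submodule.Quotient.mk_eq_zero]
      constructor
      · rintro ⟨u, hu, rfl⟩
        exact ⟨hδ 0 u hu, hαδ u hu⟩
      · rintro ⟨hx, hx'⟩
        obtain ⟨u, hu, rfl⟩ := hD₂ t ht₂ x hx hx'
        exact ⟨u, hu, rfl⟩
  have hmap : ((R.L 0).sections t).map ((rangeSec A t).mkQ ∘ₗ α) =
      (formVec fun _ => t : Submodule ℂ (Fin n → Coord)).map (rangeSec A t).mkQ := by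
    apply le_antisymm
    · rintro _ ⟨s, hs, rfl⟩
      exact ⟨_, hα s hs, rfl⟩
    · rintro _ ⟨w, hw, rfl⟩
      obtain ⟨s, hs, hsw⟩ := hD₃ t ht₃ w hw
      exact ⟨s, hs, ((Submodule.Quotient.eq _).2 hsw).symm⟩
  rw [hmap] at h0
  have hsucc : ∀ i, i < R.length → Module.finrank ℂ ((R.L (i + 1)).sections t) =
      Module.finrank ℂ (I i) + Module.finrank ℂ (I (i + 1)) := by
    intro i hi
    refine finrank_eq_map_add fun x => ?_
    constructor
    · rintro ⟨u, hu, rfl⟩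
      exact ⟨hδ _ u hu, R.mulVec_mulVec i u⟩
    · rintro ⟨hx, hx'⟩
      obtain ⟨u, hu, rfl⟩ := hD₁ i t (ht₁ i hi) x hx hx'
      exact ⟨u, hu, rfl⟩
  rw [sum_neg_one_pow_of_telescope (r := fun i => (Module.finrank ℂ (I i) : ℤ))
    (e := n * Module.finrank ℂ (forms (Fin 3) t) - dimRange A t)]
  · have h1 : Module.finrank ℂ (I R.length) = 0 := by
      have h2 := R.rank_eq_zero (R.length + 1) (Nat.lt_succ_self _)
      have h3 : Module.finrank ℂ ((R.L (R.length + 1)).sections t) = 0 := by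
        rw [finrank_formVec]
        exact Finset.sum_eq_zero fun j _ => absurd j.2 (by omega)
      have := Submodule.finrank_map_le (δ R.length) ((R.L (R.length + 1)).sections t)
      rw [h3] at this
      exact Nat.le_zero.1 this
    rw [h1]
    simp
  · rw [finrank_formVec, Finset.sum_const, Finset.card_univ, Fintype.card_fin, smul_eq_mul] at hV
    simp only [dimRange]
    zify at hV h0
    linarith
  · exact fun i hi => by exact_mod_cast hsucc i hi

end Resolution

/-! ### The bounds on the second Chern class -/

theorem isSkewPencil_of_dim_three {n r : ℕ} {A : Matrix (Fin n) (Fin n) Coord}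
    (hlin : ∀ i j, (A i j).IsHomogeneous 1) (hskew : A.transpose = -A)
    (hinj : Function.Injective fun v : Fin 3 → ℂ => A.map (eval v))
    (hrank : ∀ v : Fin 3 → ℂ, A.map (eval v) ≠ 0 → (A.map (eval v)).rank = r) :
    IsSkewPencil A r where
  linear i j := homog_natCast_iff.2 (hlin i j)
  skew := hskew
  rank_eq v hv := by
    refine hrank v fun h0 => hv (hinj ?_)
    have h1 : A.map (eval (0 : Fin 3 → ℂ)) = 0 := by
      ext i j
      have := (hlin i j).coeff_eq_zero (d := 0) (by simp)
      rw [Matrix.map_apply, Matrix.zero_apply, MvPolynomial.eval_zero, constantCoeff_eq, this]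
    exact h0.trans h1.symm

/-- Rank-nullity for `A` on vectors of forms of degree t: in high degree every section of the image
in degree t + 1 lifts. -/
theorem IsSkewPencil.dimRange_add_dimKer {n r : ℕ} {A : Matrix (Fin n) (Fin n) Coord}
    (h : IsSkewPencil A r) : ∃ D : ℤ, ∀ t, D ≤ t →
      dimRange A (t + 1) + dimKer A t = n * Module.finrank ℂ (forms (Fin 3) t) := by
  obtain ⟨D, hD⟩ := exists_forall_exists_mulVec_eq (φ := A) (a := fun _ => -1) (b := fun _ => 0)
    (by simpa using h.linear) h.rank_eq
  refine ⟨D, fun t ht => ?_⟩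
  have hV := finrank_eq_map_add (W := (formVec fun _ => t : Submodule ℂ (Fin n → Coord)))
    (K := kerSec A t) (f := A.mulVecLin.restrictScalars ℂ) fun x => Iff.rfl
  have hmap : (formVec fun _ => t : Submodule ℂ (Fin n → Coord)).map
      (A.mulVecLin.restrictScalars ℂ) = rangeSec A (t + 1) := by
    apply le_antisymm
    · rintro _ ⟨u, hu, rfl⟩
      refine ⟨?_, fun v _ => inRange_mulVec _ _ _⟩
      have := mulVec_mem_formVec (φ := A) (a := fun _ => -1) (b := fun _ => 0)
        (by simpa using h.linear) (t := t + 1) (u := u) (by simpa using hu)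
      simpa using this
    · rintro w ⟨hw, hw'⟩
      obtain ⟨u, hu, rfl⟩ := hD (t + 1) (by linarith) w (by simpa using hw) hw'
      exact ⟨u, by simpa using hu, rfl⟩
  rw [hmap, finrank_formVec, Finset.sum_const, Finset.card_univ, Fintype.card_fin,
    smul_eq_mul] at hV
  exact hV.symm

theorem HasChernClasses.hilbertPolynomial {n r : ℕ} {A : Matrix (Fin n) (Fin n) Coord}
    {hA : ∀ i j, (A i j).IsHomogeneous 1} {a b : ℤ} (hc : HasChernClasses (linearHom A hA) a b)
    (h : IsSkewPencil A r) (hn : n = r + 2) : ∃ D : ℤ, ∀ t, D ≤ t →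
      2 * (n * (Module.finrank ℂ (forms (Fin 3) t) : ℤ) - dimRange A t) =
        2 * (t + 1) * (t + 2) + (2 * t + 3) * a + (a ^ 2 - 2 * b) := by
  obtain ⟨R, hR⟩ := hc
  obtain ⟨h1, h2⟩ := powerSums_eq_of_prod_eq hR
  obtain ⟨D, hD⟩ := R.sum_finrank_sections h hn
  choose D' hD' using fun i => (R.L i).two_mul_finrank_sections
  refine ⟨∑ i ∈ Finset.range (R.length + 1), |D' i| + |D|, fun t ht => ?_⟩
  have hs : 0 ≤ ∑ i ∈ Finset.range (R.length + 1), |D' i| :=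
    Finset.sum_nonneg fun _ _ => abs_nonneg _
  rw [← hD t (by linarith [le_abs_self D]), ← h2, ← h1]
  have h3 := R.sum_rank h hn
  calc 2 * ∑ i ∈ Finset.range (R.length + 1),
        (-1) ^ i * (Module.finrank ℂ ((R.L i).sections t) : ℤ)
      = ∑ i ∈ Finset.range (R.length + 1), ((t + 1) * (t + 2) * ((-1) ^ i * ((R.L i).rank : ℤ)) +
          (2 * t + 3) * ((-1) ^ i * (R.L i).powerSum 1) + (-1) ^ i * (R.L i).powerSum 2) := by
        rw [Finset.mul_sum]
        refine Finset.sum_congr rfl fun i hi => ?_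
        have h4 := Finset.single_le_sum (f := fun i => |D' i|) (fun _ _ => abs_nonneg _) hi
        have h5 := hD' i t (by linarith [le_abs_self (D' i), abs_nonneg D])
        linear_combination (-1) ^ i * h5
    _ = _ := by
        rw [Finset.sum_add_distrib, Finset.sum_add_distrib, ← Finset.mul_sum, ← Finset.mul_sum, h3]
        ring

theorem MEffective.bounds {c : ℕ} {y : ℤ} (h : MEffective c y) :
    0 < c ∧ 0 ≤ y ∧ y ≤ ((c + 1).choose 2 : ℤ) := by
  obtain ⟨A, hA, hchern⟩ := h
  have hP : IsSkewPencil A (2 * c) :=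
    isSkewPencil_of_dim_three hA.linear hA.skew hA.dim_three hA.constant_rank
  have hcard : Fintype.card (Fin (2 * c + 2)) = 2 * c + 2 := by simp
  -- For c = 0 the matrix would have rank 0 at every nonzero point, contradicting the injectivity of
  -- v ↦ A(v).
  have hc : 0 < c := by
    rcases Nat.eq_zero_or_pos c with rfl | hc
    · have h0 : ∀ v : Fin 3 → ℂ, v ≠ 0 → A.map (eval v) = 0 := by
        classical
        intro v hv
        have h1 : Module.finrank ℂ (LinearMap.range (A.map (eval v)).mulVecLin) = 0 :=
          hP.rank_eq v hv
        rw [Submodule.finrank_eq_zero, LinearMap.range_eq_bot] at h1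
        refine Matrix.ext_of_mulVec_single fun j => ?_
        rw [← Matrix.mulVecLin_apply, h1, Matrix.zero_mulVec, LinearMap.zero_apply]
      have h2 : (2 : Fin 3 → ℂ) ≠ 0 := fun h => by simpa using congrFun h 0
      have h3 := hA.dim_three ((h0 1 one_ne_zero).trans (h0 2 h2).symm)
      have := congrFun h3 0
      norm_num at this
    · exact hc
  obtain ⟨D, hD⟩ := hchern.hilbertPolynomial hP rfl
  obtain ⟨D', hD'⟩ := hP.dimRange_add_dimKer
  -- Large enough for both asymptotic formulas, and of the form c - 1 + j required by the kernel
  -- bound.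
  set t : ℕ := c - 1 + (D.toNat + D'.toNat) with ht
  have e1 := hD t (by omega)
  have e2 := hD (t + 1) (by omega)
  have e3 := hD' t (by omega)
  have b1 := hP.finrank_rangeSec_le_plane t
  have b2 := hP.finrank_kerSec_le_plane hc hcard (D.toNat + D'.toNat)
  rw [← ht] at b2
  have f1 := two_mul_finrank_forms_three (d := t) (by omega)
  have f2 := two_mul_finrank_forms_three (d := t + 1) (by omega)
  have hch : ((c + 1).choose 2 : ℤ) * 2 = (c + 1) * c := by
    have h2 := Nat.choose_two_right (c + 1)
    rw [h2]
    have h3 : 2 ∣ (c + 1) * (c + 1 - 1) := even_iff_two_dvd.1 (Nat.even_mul_pred_self _)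
    have h4 := Nat.div_mul_cancel h3
    exact_mod_cast h4
  have ht' : (t : ℤ) = c - 1 + (D.toNat + D'.toNat : ℕ) := by omega
  generalize D.toNat + D'.toNat = j at *
  generalize (Module.finrank ℂ (forms (Fin 3) (t : ℤ))) = S at *
  generalize (Module.finrank ℂ (forms (Fin 3) ((t : ℤ) + 1))) = S' at *
  generalize dimRange A (t : ℤ) = I at *
  generalize dimRange A ((t : ℤ) + 1) = I' at *
  generalize dimKer A (t : ℤ) = K at *
  zify at b1 b2 e3
  push_cast at e1 e2 e3
  generalize (t : ℤ) = T at *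
  subst ht'
  refine ⟨hc, ?_, ?_⟩
  -- Eliminating I' between `e2` and `e3` gives 2y = c(c + 1) + 2j(c + 1 + j) - 2K, nonnegative by
  -- `b2`.
  · nlinarith
  -- Inserting I ≤ c(t + 1)² into `e1` leaves 2y ≤ c(c + 1).
  · nlinarith

/-! ### Cokernels and short resolutions -/

theorem HasPowerSums.eq {x x' : Chow} {p q : ℤ} (h : HasPowerSums x p q)
    (h' : HasPowerSums x' p q) : x = x' := by
  obtain ⟨e, he, rfl⟩ := h
  obtain ⟨e', he', rfl⟩ := h'
  obtain rfl : e = e' := by linarith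
  rfl

theorem cokerIso_of_range_eq_comap {F₁ F₀ G₁ G₀ : SplitBundle} {φ : F₁.Hom F₀} {ψ : G₁.Hom G₀}
    (π : F₀.Hom G₀) (hπ : ∀ v, v ≠ 0 → Function.Surjective (π.fibre v))
    (h : ∀ v, v ≠ 0 → LinearMap.range (φ.fibre v) =
      (LinearMap.range (ψ.fibre v)).comap (π.fibre v)) : CokerIso φ ψ := by
  refine ⟨π, fun v hv => ⟨(h v hv).le, ?_, ?_⟩⟩
  · rw [← LinearMap.ker_eq_bot, Submodule.ker_mapQ, ← h v hv, Submodule.mkQ_map_self]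
  · intro y
    obtain ⟨y, rfl⟩ := Submodule.mkQ_surjective _ y
    obtain ⟨x, rfl⟩ := hπ v hv y
    exact ⟨Submodule.Quotient.mk x, rfl⟩

theorem finrank_add_finrank_comap {V W : Type*} [AddCommGroup V] [Module ℂ V]
    [FiniteDimensional ℂ V] [AddCommGroup W] [Module ℂ W] [FiniteDimensional ℂ W]
    {f : V →ₗ[ℂ] W} (hf : Function.Surjective f) (p : Submodule ℂ W) :
    Module.finrank ℂ (p.comap f) + Module.finrank ℂ W =
      Module.finrank ℂ p + Module.finrank ℂ V := by
  have h1 := finrank_eq_map_add (W := p.comap f) (K := LinearMap.ker f) (f := f) fun x => by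
    rw [LinearMap.mem_ker, Submodule.mem_comap]
    exact ⟨fun h => ⟨h ▸ p.zero_mem, h⟩, fun h => h.2⟩
  rw [Submodule.map_comap_eq_of_surjective hf] at h1
  have h2 := LinearMap.finrank_range_add_finrank_ker f
  rw [LinearMap.range_eq_top.2 hf, finrank_top] at h2
  omega

/-! ### Chern classes from a resolution of length two -/

section ThreeTerm

/-- The terms of a resolution of length two. -/
def threeTerm (F₀ F₁ F₂ : SplitBundle) : ℕ → SplitBundle
  | 0 => F₀
  | 1 => F₁
  | 2 => F₂
  | _ + 3 => copies 0 0

variable {F₀ F₁ F₂ : SplitBundle}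

/-- The differentials of a resolution of length two. -/
def threeTermHom (d₀ : F₁.Hom F₀) (d₁ : F₂.Hom F₁) :
    ∀ i, (threeTerm F₀ F₁ F₂ (i + 1)).Hom (threeTerm F₀ F₁ F₂ i)
  | 0 => d₀
  | 1 => d₁
  | i + 2 => (threeTerm F₀ F₁ F₂ (i + 2)).fromZero

/-- The resolution given by an exact sequence `0 ⟶ F₂ ⟶ F₁ ⟶ F₀ ⟶ E ⟶ 0`. -/
def threeTermResolution {F G : SplitBundle} {φ : F.Hom G} (d₀ : F₁.Hom F₀) (d₁ : F₂.Hom F₁)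
    (aug : F₀.Hom G) (hd₁ : ∀ v, v ≠ 0 → Function.Injective (d₁.fibre v))
    (hd : ∀ v, v ≠ 0 → Function.Exact (d₁.fibre v) (d₀.fibre v))
    (haug : ∀ v, v ≠ 0 → Function.Exact (d₀.fibre v)
      ((LinearMap.range (φ.fibre v)).mkQ ∘ₗ aug.fibre v))
    (hsurj : ∀ v, v ≠ 0 → Function.Surjective
      ((LinearMap.range (φ.fibre v)).mkQ ∘ₗ aug.fibre v)) : Resolution φ where
  length := 2
  L := threeTerm F₀ F₁ F₂
  rank_eq_zero i hi := by
    obtain ⟨j, rfl⟩ : ∃ j, i = j + 3 := ⟨i - 3, by omega⟩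
    rfl
  d := threeTermHom d₀ d₁
  aug := aug
  exact v hv i := by
    match i with
    | 0 => exact hd v hv
    | 1 =>
      intro x
      constructor
      · intro hx
        exact ⟨0, ((hd₁ v hv) (hx.trans (map_zero _).symm)).symm ▸ map_zero _⟩
      · rintro ⟨y, rfl⟩
        have : y = 0 := funext fun j => Fin.elim0 j
        rw [this, map_zero, map_zero]
    | i + 2 =>
      intro x
      exact ⟨fun _ => ⟨0, funext fun j => Fin.elim0 j⟩, fun _ => by
        rw [show x = 0 from funext fun j => Fin.elim0 j, map_zero]⟩
  exact_aug := haug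
  surjective_aug := hsurj

theorem hasChernClasses_of_threeTerm {F G : SplitBundle} {φ : F.Hom G} (d₀ : F₁.Hom F₀)
    (d₁ : F₂.Hom F₁)
    (aug : F₀.Hom G) (hd₁ : ∀ v, v ≠ 0 → Function.Injective (d₁.fibre v))
    (hd : ∀ v, v ≠ 0 → Function.Exact (d₁.fibre v) (d₀.fibre v))
    (haug : ∀ v, v ≠ 0 → Function.Exact (d₀.fibre v)
      ((LinearMap.range (φ.fibre v)).mkQ ∘ₗ aug.fibre v))
    (hsurj : ∀ v, v ≠ 0 → Function.Surjective
      ((LinearMap.range (φ.fibre v)).mkQ ∘ₗ aug.fibre v)) {a b : ℤ}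
    (h₁ : a + F₁.powerSum 1 = F₀.powerSum 1 + F₂.powerSum 1)
    (h₂ : a ^ 2 - 2 * b + F₁.powerSum 2 = F₀.powerSum 2 + F₂.powerSum 2) :
    HasChernClasses φ a b := by
  refine ⟨threeTermResolution d₀ d₁ aug hd₁ hd haug hsurj, ?_⟩
  have e₁ : (Finset.range (2 + 1)).filter (fun i => Odd i) = {1} := by decide
  have e₂ : (Finset.range (2 + 1)).filter (fun i => Even i) = {0, 2} := by decide
  change _ * ∏ i ∈ (Finset.range (2 + 1)).filter (fun i => Odd i),
    (threeTerm F₀ F₁ F₂ i).totalChern = ∏ i ∈ (Finset.range (2 + 1)).filter (fun i => Even i),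
    (threeTerm F₀ F₁ F₂ i).totalChern
  rw [e₁, e₂, Finset.prod_singleton, Finset.prod_pair (by norm_num)]
  have hl : HasPowerSums (1 + (a : Chow) * lineClass + (b : Chow) * lineClass ^ 2) a
      (a ^ 2 - 2 * b) := ⟨b, by ring, rfl⟩
  have h3 := hl.mul F₁.hasPowerSums
  rw [h₁, h₂] at h3
  exact h3.eq (F₀.hasPowerSums.mul F₂.hasPowerSums)

end ThreeTerm

theorem powerSum_copies (n : ℕ) (d : ℤ) (k : ℕ) : (copies n d).powerSum k = n * d ^ k := by
  simp [SplitBundle.powerSum]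

theorem eval_add_of_isHomogeneous_one {p : Coord} (hp : p.IsHomogeneous 1) (v w : Fin 3 → ℂ) :
    eval (v + w) p = eval v p + eval w p := by
  rw [← mem_homogeneousSubmodule, homogeneousSubmodule_one_eq_span_X] at hp
  induction hp using Submodule.span_induction with
  | mem x hx =>
    obtain ⟨i, rfl⟩ := hx
    simp
  | zero => simp
  | add p q _ _ hp hq =>
    rw [map_add, map_add, map_add, hp, hq]
    ring
  | smul z p _ hp =>
    rw [smul_eval, smul_eval, smul_eval, hp]
    ring

theorem injective_map_eval {ι κ : Type*} {A : Matrix ι κ Coord}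
    (hA : ∀ i j, (A i j).IsHomogeneous 1)
    (h : ∀ v : Fin 3 → ℂ, v ≠ 0 → A.map (eval v) ≠ 0) :
    Function.Injective fun v : Fin 3 → ℂ => A.map (eval v) := by
  intro v w hvw
  by_contra hne
  refine h (v - w) (sub_ne_zero.2 hne) ?_
  ext i j
  have h1 := eval_add_of_isHomogeneous_one (hA i j) (v - w) w
  have h2 := congrFun (congrFun hvw i) j
  simp only [Matrix.map_apply] at h2
  rw [sub_add_cancel, h2] at h1
  simpa using h1

theorem isSkewConstantRank_of_rank {c : ℕ} (hc : 0 < c)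
    {A : Matrix (Fin (2 * c + 2)) (Fin (2 * c + 2)) Coord}
    (hlin : ∀ i j, (A i j).IsHomogeneous 1) (hskew : A.transpose = -A)
    (hrank : ∀ v : Fin 3 → ℂ, v ≠ 0 → (A.map (eval v)).rank = 2 * c) :
    IsSkewConstantRank c A where
  linear := hlin
  skew := hskew
  dim_three := injective_map_eval hlin fun v hv h0 => by
    have h1 := hrank v hv
    rw [h0, Matrix.rank_zero] at h1
    omega
  constant_rank v hv := hrank v fun h0 => hv (by
    subst h0
    ext i j
    rw [Matrix.map_apply, Matrix.zero_apply, MvPolynomial.eval_zero, constantCoeff_eq,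
      (hlin i j).coeff_eq_zero (by simp)])

/-! ### Steiner bundles -/

section Steiner

variable {c : ℕ}

/-- The decomposition of the index set of a matrix of size `2c + 2` into blocks of size `c` and
`c + 2`. -/
def blockEquiv (c : ℕ) : Fin c ⊕ Fin (c + 2) ≃ Fin (2 * c + 2) :=
  finSumFinEquiv.trans (finCongr (by omega))

/-- The skew-symmetric matrix with off-diagonal blocks `-B` and its transpose. -/
def skewBlock {R : Type*} [CommRing R] (B : Matrix (Fin (c + 2)) (Fin c) R) :
    Matrix (Fin (2 * c + 2)) (Fin (2 * c + 2)) R :=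
  Matrix.reindex (blockEquiv c) (blockEquiv c) (Matrix.fromBlocks 0 B.transpose (-B) 0)

theorem skewBlock_transpose {R : Type*} [CommRing R] (B : Matrix (Fin (c + 2)) (Fin c) R) :
    (skewBlock B).transpose = -skewBlock B := by
  rw [skewBlock, Matrix.transpose_reindex, Matrix.fromBlocks_transpose]
  ext i j
  simp only [Matrix.reindex_apply, Matrix.submatrix_apply, Matrix.neg_apply]
  rcases (blockEquiv c).symm i with i | i <;> rcases (blockEquiv c).symm j with j | j <;> simp

theorem skewBlock_linear {B : Matrix (Fin (c + 2)) (Fin c) Coord}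
    (hB : ∀ i j, (B i j).IsHomogeneous 1) (i j : Fin (2 * c + 2)) :
    (skewBlock B i j).IsHomogeneous 1 := by
  simp only [skewBlock, Matrix.reindex_apply, Matrix.submatrix_apply]
  rcases (blockEquiv c).symm i with i | i <;> rcases (blockEquiv c).symm j with j | j
  · exact isHomogeneous_zero _ _ _
  · exact hB j i
  · exact (hB i j).neg
  · exact isHomogeneous_zero _ _ _

theorem skewBlock_map (B : Matrix (Fin (c + 2)) (Fin c) Coord) (v : Fin 3 → ℂ) :
    (skewBlock B).map (eval v) = skewBlock (B.map (eval v)) := by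
  ext i j
  simp only [skewBlock, Matrix.reindex_apply, Matrix.submatrix_apply, Matrix.map_apply]
  rcases (blockEquiv c).symm i with i | i <;> rcases (blockEquiv c).symm j with j | j <;> simp

/-- The projection onto the block of size `c + 2`. -/
def blockProj (R : Type*) [CommRing R] (c : ℕ) : Matrix (Fin (c + 2)) (Fin (2 * c + 2)) R :=
  Matrix.of fun i j => if blockEquiv c (Sum.inr i) = j then 1 else 0

theorem blockProj_mulVec {R : Type*} [CommRing R] (w : Fin (2 * c + 2) → R) (i : Fin (c + 2)) :
    (blockProj R c).mulVec w i = w (blockEquiv c (Sum.inr i)) := by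
  simp [blockProj, Matrix.mulVec, dotProduct]

theorem blockProj_transpose_mulVec {R : Type*} [CommRing R] (w : Fin (c + 2) → R) :
    (blockProj R c).transpose.mulVec w = Sum.elim (0 : Fin c → R) w ∘ (blockEquiv c).symm := by
  ext j
  obtain ⟨j, rfl⟩ := (blockEquiv c).surjective j
  rcases j with j | j <;> simp [blockProj, Matrix.mulVec, dotProduct]

theorem blockProj_map (v : Fin 3 → ℂ) : (blockProj Coord c).map (eval v) = blockProj ℂ c := by
  ext i j
  simp [blockProj, apply_ite]

theorem skewBlock_mulVec {R : Type*} [CommRing R] (B : Matrix (Fin (c + 2)) (Fin c) R)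
    (a : Fin c → R) (b : Fin (c + 2) → R) :
    (skewBlock B).mulVec (Sum.elim a b ∘ (blockEquiv c).symm) =
      Sum.elim (B.transpose.mulVec b) (-B.mulVec a) ∘ (blockEquiv c).symm := by
  rw [skewBlock, Matrix.reindex_apply, Matrix.submatrix_mulVec_equiv, Matrix.fromBlocks_mulVec]
  congr 1
  have : (Sum.elim a b ∘ (blockEquiv c).symm) ∘ (blockEquiv c).symm.symm = Sum.elim a b := by
    ext i; simp
  rw [this]
  simp [Matrix.neg_mulVec]

/-- Injectivity of `M` makes Mᵀ surjective, so the first block of the image is everything and the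
second is the image of `M`. The cokernel is therefore that of `M`. -/
theorem range_skewBlock {M : Matrix (Fin (c + 2)) (Fin c) ℂ}
    (hM : Function.Injective M.mulVecLin) :
    LinearMap.range (skewBlock M).mulVecLin =
      (LinearMap.range M.mulVecLin).comap (blockProj ℂ c).mulVecLin := by
  have hsurj : Function.Surjective M.transpose.mulVecLin := by
    rw [← LinearMap.range_eq_top]
    apply Submodule.eq_top_of_finrank_eq
    change M.transpose.rank = _
    rw [Matrix.rank_transpose, Matrix.rank, LinearMap.finrank_range_of_inj hM]
  apply le_antisymm
  · rintro _ ⟨w, rfl⟩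
    obtain ⟨a, b, rfl⟩ : ∃ a b, w = Sum.elim a b ∘ (blockEquiv c).symm :=
      ⟨fun i => w (blockEquiv c (Sum.inl i)), fun i => w (blockEquiv c (Sum.inr i)), by
        ext j
        obtain ⟨j, rfl⟩ := (blockEquiv c).surjective j
        rcases j with j | j <;> simp⟩
    refine ⟨-a, ?_⟩
    rw [Matrix.mulVecLin_apply, Matrix.mulVecLin_apply, Matrix.mulVecLin_apply, skewBlock_mulVec]
    ext i
    rw [blockProj_mulVec, Matrix.mulVec_neg]
    simp
  · rintro w ⟨a, ha⟩
    obtain ⟨b, hb⟩ := hsurj fun i => w (blockEquiv c (Sum.inl i))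
    refine ⟨Sum.elim (-a) b ∘ (blockEquiv c).symm, ?_⟩
    rw [Matrix.mulVecLin_apply] at *
    rw [skewBlock_mulVec, hb, Matrix.mulVec_neg, neg_neg, ha]
    ext j
    obtain ⟨j, rfl⟩ := (blockEquiv c).surjective j
    rcases j with j | j
    · simp
    · simp [blockProj_mulVec]

theorem surjective_blockProj (c : ℕ) : Function.Surjective (blockProj ℂ c).mulVecLin := by
  intro w
  refine ⟨Sum.elim 0 w ∘ (blockEquiv c).symm, ?_⟩
  ext i
  simp [blockProj_mulVec]

variable {B : Matrix (Fin (c + 2)) (Fin c) Coord}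

theorem IsSteiner.isSkewConstantRank (hB : IsSteiner c B) (hc : 0 < c) :
    IsSkewConstantRank c (skewBlock B) := by
  refine isSkewConstantRank_of_rank hc (skewBlock_linear hB.linear) (skewBlock_transpose B)
    fun v hv => ?_
  have hinj : Function.Injective (B.map (eval v)).mulVecLin := hB.injective v hv
  have h1 := finrank_add_finrank_comap (surjective_blockProj c)
    (LinearMap.range (B.map (eval v)).mulVecLin)
  rw [← range_skewBlock hinj, LinearMap.finrank_range_of_inj hinj,
    Module.finrank_fintype_fun_eq_card, Module.finrank_fintype_fun_eq_card,
    Module.finrank_fintype_fun_eq_card] at h1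
  simp only [Fintype.card_fin] at h1
  rw [skewBlock_map, Matrix.rank]
  omega

/-- The projection of trivial bundles onto the block of size `c + 2`. -/
noncomputable def blockProjHom (c : ℕ) : (copies (2 * c + 2) 0).Hom (copies (c + 2) 0) where
  mat := blockProj Coord c
  isForm i j := isForm_of_isHomogeneous (k := 0) (by
    simp only [blockProj, Matrix.of_apply]
    split_ifs
    · exact isHomogeneous_one _ _
    · exact isHomogeneous_zero _ _ _) (by simp)

/-- The inclusion of trivial bundles of the block of size `c + 2`. -/
noncomputable def blockInclHom (c : ℕ) : (copies (c + 2) 0).Hom (copies (2 * c + 2) 0) where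
  mat := (blockProj Coord c).transpose
  isForm i j := (blockProjHom c).isForm j i

theorem blockProjHom_fibre (v : Fin 3 → ℂ) :
    (blockProjHom c).fibre v = (blockProj ℂ c).mulVecLin := by
  rw [← blockProj_map v]; rfl

theorem blockInclHom_fibre (v : Fin 3 → ℂ) :
    (blockInclHom c).fibre v = (blockProj ℂ c).transpose.mulVecLin := by
  rw [← blockProj_map v]; rfl

theorem blockProj_mulVec_transpose (w : Fin (c + 2) → ℂ) :
    (blockProj ℂ c).mulVec ((blockProj ℂ c).transpose.mulVec w) = w := by
  ext i
  rw [blockProj_mulVec, blockProj_transpose_mulVec]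
  simp

theorem linearHom_fibre {m n : ℕ} (A : Matrix (Fin m) (Fin n) Coord)
    (hA : ∀ i j, (A i j).IsHomogeneous 1) (v : Fin 3 → ℂ) :
    (linearHom A hA).fibre v = (A.map (eval v)).mulVecLin := rfl

theorem IsSteiner.range_fibre (hB : IsSteiner c B)
    (hA : ∀ i j, (skewBlock B i j).IsHomogeneous 1) {v : Fin 3 → ℂ} (hv : v ≠ 0) :
    LinearMap.range ((linearHom (skewBlock B) hA).fibre v) =
      (LinearMap.range ((linearHom B hB.linear).fibre v)).comap ((blockProjHom c).fibre v) := by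
  rw [linearHom_fibre, skewBlock_map, blockProjHom_fibre]
  exact range_skewBlock (hB.injective v hv)

theorem IsSteiner.cokerIso (hB : IsSteiner c B) (hA : ∀ i j, (skewBlock B i j).IsHomogeneous 1) :
    CokerIso (linearHom (skewBlock B) hA) (linearHom B hB.linear) := by
  refine cokerIso_of_range_eq_comap (blockProjHom c) (fun v _ => ?_)
    fun v hv => hB.range_fibre hA hv
  rw [blockProjHom_fibre]
  exact surjective_blockProj c

theorem two_mul_choose_two (c : ℕ) : 2 * ((c + 1).choose 2 : ℤ) = c * (c + 1) := by
  have h3 : 2 ∣ (c + 1) * (c + 1 - 1) := even_iff_two_dvd.1 (Nat.even_mul_pred_self _)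
  have h4 := Nat.mul_div_cancel' h3
  rw [← Nat.choose_two_right, Nat.add_sub_cancel] at h4
  zify at h4
  linarith

theorem IsSteiner.hasChernClasses (hB : IsSteiner c B)
    (hA : ∀ i j, (skewBlock B i j).IsHomogeneous 1) :
    HasChernClasses (linearHom (skewBlock B) hA) c ((c + 1).choose 2 : ℤ) := by
  have hmem : ∀ v : Fin 3 → ℂ, v ≠ 0 → ∀ w, (blockInclHom c).fibre v w ∈
      LinearMap.range ((linearHom (skewBlock B) hA).fibre v) ↔
      w ∈ LinearMap.range ((linearHom B hB.linear).fibre v) := by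
    intro v hv w
    rw [hB.range_fibre hA hv, Submodule.mem_comap, blockProjHom_fibre, blockInclHom_fibre,
      Matrix.mulVecLin_apply, Matrix.mulVecLin_apply]
    rw [blockProj_mulVec_transpose]
  refine hasChernClasses_of_threeTerm (linearHom B hB.linear) (copies c (-1)).fromZero
    (blockInclHom c) (fun v _ => ?_) (fun v hv x => ?_) (fun v hv x => ?_) (fun v hv y => ?_) ?_ ?_
  · exact fun x y _ => funext fun j => Fin.elim0 j
  · constructor
    · intro hx
      exact ⟨0, (map_zero _).trans (hB.injective v hv (hx.trans (map_zero _).symm)).symm⟩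
    · rintro ⟨y, rfl⟩
      rw [show y = 0 from funext fun j => Fin.elim0 j, map_zero, map_zero]
  · rw [LinearMap.comp_apply, Submodule.mkQ_apply, Submodule.Quotient.mk_eq_zero]
    exact hmem v hv x
  · obtain ⟨y, rfl⟩ := Submodule.mkQ_surjective _ y
    refine ⟨(blockProjHom c).fibre v y, ?_⟩
    rw [LinearMap.comp_apply, Submodule.mkQ_apply, Submodule.mkQ_apply, Submodule.Quotient.eq,
      hB.range_fibre hA hv, Submodule.mem_comap, map_sub, blockProjHom_fibre, blockInclHom_fibre,
      Matrix.mulVecLin_apply, Matrix.mulVecLin_apply, Matrix.mulVecLin_apply]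
    rw [blockProj_mulVec_transpose, sub_self]
    exact zero_mem _
  · rw [powerSum_copies, powerSum_copies, powerSum_copies]
    simp
  · rw [powerSum_copies, powerSum_copies, powerSum_copies, two_mul_choose_two]
    ring_nf

/-- The banded matrix with the three coordinates on its diagonals. -/
noncomputable def banded (c : ℕ) : Matrix (Fin (c + 2)) (Fin c) Coord :=
  Matrix.of fun i j => if h : (j : ℕ) ≤ i ∧ (i : ℕ) - j < 3 then X ⟨i - j, h.2⟩ else 0

/-- At v the matrix is multiplication of polynomials of degree < c by v₀ + v₁T + v₂T², which is
injective: with v_m the lowest nonzero coefficient, row j + m determines u_j from the earlier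
entries. -/
theorem isSteiner_banded (c : ℕ) : IsSteiner c (banded c) := by
  have hlin : ∀ i j, (banded c i j).IsHomogeneous 1 := by
    intro i j
    simp only [banded, Matrix.of_apply]
    split_ifs
    · exact isHomogeneous_X _ _
    · exact isHomogeneous_zero _ _ _
  refine ⟨hlin, fun v hv => ?_⟩
  rw [← LinearMap.ker_eq_bot, LinearMap.ker_eq_bot']
  intro u hu
  classical
  obtain ⟨m, hm, hmin⟩ : ∃ m : Fin 3, v m ≠ 0 ∧ ∀ k < m, v k = 0 := by
    have hex : ∃ m : Fin 3, v m ≠ 0 := by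
      by_contra! hc; exact hv (funext hc)
    exact ⟨Fin.find _ hex, Fin.find_spec hex, fun k hk => by simpa using Fin.find_min hex hk⟩
  have key : ∀ N : ℕ, ∀ j : Fin c, (j : ℕ) = N → u j = 0 := by
    intro N
    induction N using Nat.strong_induction_on with
    | _ N ih =>
      rintro j rfl
      have hrow := congrFun hu (⟨j + m, by omega⟩ : Fin (c + 2))
      change ∑ j', eval v (banded c ⟨j + m, _⟩ j') * u j' = 0 at hrow
      rw [Finset.sum_eq_single j] at hrow
      · have e : eval v (banded c ⟨j + m, by omega⟩ j) = v m := by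
          simp [banded]
        rw [e] at hrow
        exact (mul_eq_zero.1 hrow).resolve_left hm
      · intro j' _ hne
        rcases lt_or_gt_of_ne (Fin.val_ne_of_ne hne) with h | h
        · rw [ih j' h j' rfl, mul_zero]
        · have e : eval v (banded c ⟨j + m, by omega⟩ j') = 0 := by
            simp only [banded, Matrix.of_apply]
            split_ifs with hb
            · rw [eval_X]
              refine hmin _ ?_
              rw [Fin.lt_def]
              dsimp only at *
              omega
            · exact map_zero _
          rw [e, zero_mul]
      · simp
  exact funext fun j => key j j rfl

end Steiner

/-! ### A skew-symmetric matrix whose cokernel splits -/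

section Split

variable {R : Type*} [CommRing R]

/-- The entries of the core of size `2c + 1` of the matrix, which is supported near the
antidiagonal. -/
def splitEntry (c : ℕ) (x y z : R) (i j : ℕ) : R :=
  if i ≤ 2 * c ∧ j ≤ 2 * c then
    (((j : ℤ) - i).sign : R) *
      (if i + j + 1 = 2 * c then x else if i + j = 2 * c then z
        else if i + j = 2 * c + 1 then y else 0)
  else 0

/-- The skew-symmetric matrix `splitEntry`, with a zero row and column added. -/
def splitMat (c : ℕ) (x y z : R) : Matrix (Fin (2 * c + 2)) (Fin (2 * c + 2)) R :=
  Matrix.of fun i j => splitEntry c x y z i j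

theorem splitMat_transpose (c : ℕ) (x y z : R) :
    (splitMat c x y z).transpose = -splitMat c x y z := by
  ext i j
  simp only [splitMat, Matrix.transpose_apply, Matrix.of_apply, Matrix.neg_apply, splitEntry]
  by_cases h : (i : ℕ) ≤ 2 * c ∧ (j : ℕ) ≤ 2 * c
  · rw [if_pos h, if_pos h.symm, add_comm (j : ℕ) i,
      show ((i : ℤ) - j) = -((j : ℤ) - i) by ring, Int.sign_neg, Int.cast_neg, neg_mul]
  · rw [if_neg h, if_neg fun h' => h h'.symm, neg_zero]

/-- Reading the rows from the bottom turns the antidiagonal matrix into a tridiagonal one: row 2c -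
k involves only the entries k - 1, k, k + 1 of u. The tests on k suppress the terms outside the
core, including the truncated k - 1 at k = 0. -/
theorem sum_splitEntry (c : ℕ) (x y z : R) (u : ℕ → R) {k : ℕ} (hk : k ≤ 2 * c) :
    ∑ j ∈ Finset.range (2 * c + 2), splitEntry c x y z (2 * c - k) j * u j =
      (if 1 ≤ k then ((2 * k - 1 - 2 * c : ℤ).sign : R) * x * u (k - 1) else 0) +
        ((2 * k - 2 * c : ℤ).sign : R) * z * u k +
        (if k < 2 * c then ((2 * k + 1 - 2 * c : ℤ).sign : R) * y * u (k + 1) else 0) := by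
  have h1 : ∀ j ∈ Finset.range (2 * c + 2), splitEntry c x y z (2 * c - k) j * u j =
      (if j = k - 1 then (if 1 ≤ k then ((2 * k - 1 - 2 * c : ℤ).sign : R) * x * u (k - 1) else 0)
        else 0) +
      (if j = k then ((2 * k - 2 * c : ℤ).sign : R) * z * u k else 0) +
      (if j = k + 1 then
        (if k < 2 * c then ((2 * k + 1 - 2 * c : ℤ).sign : R) * y * u (k + 1) else 0) else 0) := by
    intro j hj
    rw [Finset.mem_range] at hj
    have hki : ((2 * c - k : ℕ) : ℤ) = 2 * c - k := by omega
    unfold splitEntry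
    rw [hki]
    by_cases hj' : j ≤ 2 * c
    · rw [if_pos ⟨by omega, hj'⟩]
      rcases lt_trichotomy j k with h | rfl | h
      · rw [if_neg (show j ≠ k by omega), if_neg (show j ≠ k + 1 by omega)]
        by_cases h' : j + 1 = k
        · subst h'
          rw [if_pos (by omega), if_pos (by omega), if_pos (by omega), Nat.add_sub_cancel]
          push_cast
          rw [show (j : ℤ) - (2 * c - (j + 1)) = 2 * (j + 1) - 1 - 2 * c by ring]
          ring
        · rw [if_neg (by omega), if_neg (by omega), if_neg (by omega), if_neg (by omega)]
          ring
      · rw [if_neg (by omega), if_pos (by omega), if_pos rfl, if_neg (show j ≠ j + 1 by omega)]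
        rw [show (j : ℤ) - (2 * c - j) = 2 * j - 2 * c by ring]
        by_cases h' : 1 ≤ j
        · rw [if_neg (by omega)]; ring
        · rw [if_neg h']; simp
      · rw [if_neg (show j ≠ k by omega), if_neg (show j ≠ k - 1 by omega)]
        by_cases h' : j = k + 1
        · subst h'
          rw [if_neg (by omega), if_neg (by omega), if_pos (by omega), if_pos rfl,
            if_pos (by omega)]
          push_cast
          rw [show (k : ℤ) + 1 - (2 * c - k) = 2 * k + 1 - 2 * c by ring]
          ring
        · rw [if_neg (by omega), if_neg (by omega), if_neg (by omega), if_neg h']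
          ring
    · rw [if_neg (by omega), if_neg (by omega), if_neg (by omega)]
      by_cases h' : j = k + 1
      · rw [if_pos h', if_neg (by omega)]; simp
      · rw [if_neg h']; simp
  rw [Finset.sum_congr rfl h1, Finset.sum_add_distrib, Finset.sum_add_distrib,
    Finset.sum_ite_eq', Finset.sum_ite_eq', Finset.sum_ite_eq',
    if_pos (Finset.mem_range.2 (show k - 1 < 2 * c + 2 by omega)),
    if_pos (Finset.mem_range.2 (show k < 2 * c + 2 by omega)),
    if_pos (Finset.mem_range.2 (show k + 1 < 2 * c + 2 by omega))]

/-- A two-variable form of the Chebyshev polynomials of the second kind. -/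
def chebyshev (x y z : R) : ℕ → R
  | 0 => 1
  | 1 => z
  | m + 2 => z * chebyshev x y z (m + 1) - x * y * chebyshev x y z m

/-- The kernel vector of `splitEntry`. -/
def kerEntry (c : ℕ) (x y z : R) (k : ℕ) : R :=
  if k < c then (-1) ^ k * y ^ (c - k) * chebyshev x y z k
  else if k ≤ 2 * c then (-1) ^ (2 * c - k) * x ^ (k - c) * chebyshev x y z (2 * c - k)
  else 0

theorem kerEntry_low {c : ℕ} (x y z : R) {k : ℕ} (hk : k ≤ c) :
    kerEntry c x y z k = (-1) ^ k * y ^ (c - k) * chebyshev x y z k := by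
  unfold kerEntry
  split_ifs with h1 h2
  · rfl
  · obtain rfl : k = c := by omega
    simp [show 2 * k - k = k by omega]
  · omega

theorem kerEntry_high {c : ℕ} (x y z : R) {m : ℕ} (hm : m ≤ c) :
    kerEntry c x y z (2 * c - m) = (-1) ^ m * x ^ (c - m) * chebyshev x y z m := by
  unfold kerEntry
  rw [if_neg (by omega), if_pos (by omega), show 2 * c - (2 * c - m) = m by omega,
    show 2 * c - m - c = c - m by omega]

/-- For k ≠ c the three signs agree and the relation is the Chebyshev recurrence. At k = c the
z-term has sign zero, and the x- and y-terms cancel because the two halves of the kernel vector are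
exchanged by x ↔ y. -/
theorem sum_splitEntry_mul_kerEntry {c : ℕ} (hc : 0 < c) (x y z : R) {k : ℕ} (hk : k ≤ 2 * c) :
    ∑ j ∈ Finset.range (2 * c + 2), splitEntry c x y z (2 * c - k) j * kerEntry c x y z j = 0 := by
  rw [sum_splitEntry c x y z _ hk]
  rcases lt_trichotomy k c with h | rfl | h
  · rw [if_pos (show k < 2 * c by omega), Int.sign_eq_neg_one_of_neg (show (2 * k - 1 - 2 * c : ℤ) < 0 by omega),
      Int.sign_eq_neg_one_of_neg (show (2 * k - 2 * c : ℤ) < 0 by omega),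
      Int.sign_eq_neg_one_of_neg (show (2 * k + 1 - 2 * c : ℤ) < 0 by omega)]
    rw [kerEntry_low x y z (k := k) (by omega), kerEntry_low x y z (k := k + 1) (by omega)]
    obtain ⟨d, rfl⟩ : ∃ d, c = k + 1 + d := ⟨c - (k + 1), by omega⟩
    rw [show k + 1 + d - k = d + 1 by omega, show k + 1 + d - (k + 1) = d by omega]
    match k with
    | 0 =>
      simp [chebyshev]
      ring
    | k + 1 =>
      rw [if_pos (by omega), Nat.add_sub_cancel, kerEntry_low x y z (k := k) (by omega),
        show k + 1 + 1 + d - k = d + 2 by omega]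
      rw [chebyshev]
      push_cast
      ring
  · rw [if_pos (by omega), if_pos (by omega),
      Int.sign_eq_neg_one_of_neg (show (2 * k - 1 - 2 * k : ℤ) < 0 by omega),
      show (2 * k - 2 * k : ℤ) = 0 by ring,
      Int.sign_eq_one_of_pos (show 0 < (2 * k + 1 - 2 * k : ℤ) by omega)]
    obtain ⟨d, rfl⟩ : ∃ d, k = d + 1 := ⟨k - 1, by omega⟩
    have h2 := kerEntry_high x y z (c := d + 1) (m := d) (by omega)
    rw [show 2 * (d + 1) - d = d + 1 + 1 by omega] at h2
    rw [h2, Nat.add_sub_cancel, kerEntry_low x y z (k := d) (by omega),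
      show d + 1 - d = 1 by omega]
    simp
    ring
  · rw [if_pos (by omega), Int.sign_eq_one_of_pos (show 0 < (2 * k - 1 - 2 * c : ℤ) by omega),
      Int.sign_eq_one_of_pos (show 0 < (2 * k - 2 * c : ℤ) by omega),
      Int.sign_eq_one_of_pos (show 0 < (2 * k + 1 - 2 * c : ℤ) by omega)]
    obtain ⟨m, rfl⟩ : ∃ m, k = 2 * c - m := ⟨2 * c - k, by omega⟩
    obtain ⟨d, rfl⟩ : ∃ d, c = m + 1 + d := ⟨c - (m + 1), by omega⟩
    have e1 := kerEntry_high x y z (c := m + 1 + d) (m := m + 1) (by omega)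
    rw [show 2 * (m + 1 + d) - m - 1 = 2 * (m + 1 + d) - (m + 1) by omega, e1,
      kerEntry_high x y z (m := m) (by omega)]
    rw [show m + 1 + d - m = d + 1 by omega, show m + 1 + d - (m + 1) = d by omega]
    match m with
    | 0 =>
      rw [if_neg (by omega)]
      simp [chebyshev]
      ring
    | m + 1 =>
      have e2 := kerEntry_high x y z (c := m + 1 + 1 + d) (m := m) (by omega)
      rw [if_pos (by omega), show 2 * (m + 1 + 1 + d) - (m + 1) + 1 =
        2 * (m + 1 + 1 + d) - m by omega, e2, show m + 1 + 1 + d - m = d + 2 by omega]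
      rw [chebyshev]
      push_cast
      ring

/-- The matrix with columns the two generators of the kernel of `splitMat`. -/
def kerMat (c : ℕ) (x y z : R) : Matrix (Fin (2 * c + 2)) (Fin 2) R :=
  Matrix.of fun i j => ![if (i : ℕ) = 2 * c + 1 then 1 else 0, kerEntry c x y z i] j

theorem splitMat_mul_kerMat {c : ℕ} (hc : 0 < c) (x y z : R) :
    splitMat c x y z * kerMat c x y z = 0 := by
  ext i j
  rw [Matrix.mul_apply, Matrix.zero_apply]
  simp only [splitMat, kerMat, Matrix.of_apply]
  by_cases hi : (i : ℕ) ≤ 2 * c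
  · fin_cases j
    · refine Finset.sum_eq_zero fun k _ => ?_
      by_cases hk : (k : ℕ) = 2 * c + 1
      · simp [splitEntry, hk]
      · simp [hk]
    · have h := sum_splitEntry_mul_kerEntry hc x y z (k := 2 * c - i) (by omega)
      rw [show 2 * c - (2 * c - (i : ℕ)) = i by omega, Finset.sum_range] at h
      exact h
  · exact Finset.sum_eq_zero fun k _ => by simp [splitEntry, hi]

theorem splitMat_map {S : Type*} [CommRing S] (f : R →+* S) (c : ℕ) (x y z : R) :
    (splitMat c x y z).map f = splitMat c (f x) (f y) (f z) := by
  ext i j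
  simp only [splitMat, splitEntry, Matrix.map_apply, Matrix.of_apply]
  split_ifs <;> simp

theorem chebyshev_map {S : Type*} [CommRing S] (f : R →+* S) (x y z : R) (m : ℕ) :
    f (chebyshev x y z m) = chebyshev (f x) (f y) (f z) m := by
  induction m using Nat.twoStepInduction with
  | zero => simp [chebyshev]
  | one => simp [chebyshev]
  | more m h1 h2 => simp [chebyshev, h1, h2]

theorem kerMat_map {S : Type*} [CommRing S] (f : R →+* S) (c : ℕ) (x y z : R) :
    (kerMat c x y z).map f = kerMat c (f x) (f y) (f z) := by
  ext i j
  fin_cases j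
  · simp only [kerMat, Matrix.map_apply, Matrix.of_apply]
    by_cases h : (i : ℕ) = 2 * c + 1 <;> simp [h]
  · simp only [kerMat, kerEntry, Matrix.map_apply, Matrix.of_apply]
    simp [apply_ite f, chebyshev_map]

theorem mulVec_splitMat {c : ℕ} {x y z : ℂ} {u : Fin (2 * c + 2) → ℂ}
    (hu : (splitMat c x y z).mulVec u = 0) {w : ℕ → ℂ} (hw : ∀ i : Fin (2 * c + 2), w i = u i)
    {k : ℕ} (hk : k ≤ 2 * c) :
    (if 1 ≤ k then ((2 * k - 1 - 2 * c : ℤ).sign : ℂ) * x * w (k - 1) else 0) +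
        ((2 * k - 2 * c : ℤ).sign : ℂ) * z * w k +
        (if k < 2 * c then ((2 * k + 1 - 2 * c : ℤ).sign : ℂ) * y * w (k + 1) else 0) = 0 := by
  rw [← sum_splitEntry c x y z w hk, Finset.sum_range]
  have h := congrFun hu ⟨2 * c - k, by omega⟩
  simp only [Matrix.mulVec, dotProduct, splitMat, Matrix.of_apply, Pi.zero_apply] at h
  simpa only [hw] using h

/-- This bounds the kernel by dimension two. If x ≠ 0, the three-term relations solve downwards from
entry 2c; if x = 0 and y ≠ 0, upwards from entry 0; if only z ≠ 0, every core entry except the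
central one is killed outright. -/
theorem exists_coordinate_of_mulVec_splitMat (c : ℕ) {x y z : ℂ}
    (hxyz : x ≠ 0 ∨ y ≠ 0 ∨ z ≠ 0) : ∃ p : Fin (2 * c + 2), ∀ u : Fin (2 * c + 2) → ℂ,
      (splitMat c x y z).mulVec u = 0 → u p = 0 → u (Fin.last _) = 0 → u = 0 := by
  have hsign : ∀ a : ℤ, a ≠ 0 → ((a.sign : ℤ) : ℂ) ≠ 0 := fun a ha => by
    rw [Ne, Int.cast_eq_zero, Int.sign_eq_zero_iff_zero]; exact ha
  by_cases hx : x = 0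
  · by_cases hy : y = 0
    · have hz : z ≠ 0 := by tauto
      subst hx hy
      refine ⟨⟨c, by omega⟩, fun u hu hp hl => funext fun i => ?_⟩
      let w : ℕ → ℂ := fun j => if h : j < 2 * c + 2 then u ⟨j, h⟩ else 0
      have hw : ∀ i : Fin (2 * c + 2), w i = u i := fun i => by simp [w]
      by_cases hi : i = Fin.last _
      · rw [hi]; exact hl
      · have hi' : (i : ℕ) ≤ 2 * c := by
          have := Fin.val_ne_of_ne hi
          have h2 : (Fin.last (2 * c + 1) : ℕ) = 2 * c + 1 := rfl
          omega
        by_cases hic : (i : ℕ) = c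
        · rw [show i = ⟨c, by omega⟩ from Fin.ext hic]; exact hp
        · have h := mulVec_splitMat hu hw hi'
          rw [hw] at h
          simp only [mul_zero, zero_mul, ite_self, zero_add, add_zero] at h
          exact (mul_eq_zero.1 h).resolve_left (mul_ne_zero (hsign _ (by omega)) hz)
    · refine ⟨0, fun u hu hp hl => ?_⟩
      let w : ℕ → ℂ := fun j => if h : j < 2 * c + 2 then u ⟨j, h⟩ else 0
      have hw : ∀ i : Fin (2 * c + 2), w i = u i := fun i => by simp [w]
      have key : ∀ k, k ≤ 2 * c → w k = 0 := by
        intro k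
        induction k using Nat.strong_induction_on with
        | _ k ih =>
          intro hk
          match k with
          | 0 => rw [← hp]; exact hw 0
          | k + 1 =>
            have h := mulVec_splitMat hu hw (k := k) (by omega)
            rw [ih k (by omega) (by omega), ih (k - 1) (by omega) (by omega),
              if_pos (show k < 2 * c by omega)] at h
            simp only [mul_zero, ite_self, zero_add] at h
            exact (mul_eq_zero.1 h).resolve_left (mul_ne_zero (hsign _ (by omega)) hy)
      ext i
      refine Fin.lastCases hl (fun i => ?_) i
      rw [← hw]
      exact key _ (by simp; omega)
  · refine ⟨⟨2 * c, by omega⟩, fun u hu hp hl => ?_⟩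
    let w : ℕ → ℂ := fun j => if h : j < 2 * c + 2 then u ⟨j, h⟩ else 0
    have hw : ∀ i : Fin (2 * c + 2), w i = u i := fun i => by simp [w]
    have hwl : w (2 * c + 1) = 0 := by rw [← hl]; exact hw (Fin.last _)
    have key : ∀ m, m ≤ 2 * c → w (2 * c - m) = 0 := by
      intro m
      induction m using Nat.strong_induction_on with
      | _ m ih =>
        intro hm
        match m with
        | 0 => rw [← hp]; exact hw ⟨2 * c, by omega⟩
        | m + 1 =>
          have h := mulVec_splitMat hu hw (k := 2 * c - m) (by omega)
          have h1 : w (2 * c - m + 1) = 0 := by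
            rcases Nat.eq_zero_or_pos m with rfl | hm0
            · exact hwl
            · have := ih (m - 1) (by omega) (by omega)
              rwa [show 2 * c - (m - 1) = 2 * c - m + 1 by omega] at this
          rw [ih m (by omega) (by omega), h1, if_pos (by omega)] at h
          simp only [mul_zero, ite_self, add_zero] at h
          rw [show 2 * c - (m + 1) = 2 * c - m - 1 by omega]
          exact (mul_eq_zero.1 h).resolve_left (mul_ne_zero (hsign _ (by omega)) hx)
    ext i
    refine Fin.lastCases hl (fun i => ?_) i
    rw [← hw]
    have := key (2 * c - i) (by omega)
    rwa [show 2 * c - (2 * c - (i : ℕ)) = i by omega] at this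

theorem exists_kerEntry_ne_zero (c : ℕ) {x y z : ℂ} (hxyz : x ≠ 0 ∨ y ≠ 0 ∨ z ≠ 0) :
    ∃ p : ℕ, p ≤ 2 * c ∧ kerEntry c x y z p ≠ 0 := by
  by_cases hx : x = 0
  · by_cases hy : y = 0
    · have hz : z ≠ 0 := by tauto
      subst hx hy
      refine ⟨c, by omega, ?_⟩
      have : ∀ m, chebyshev (0 : ℂ) 0 z m = z ^ m := by
        intro m
        induction m using Nat.twoStepInduction with
        | zero => simp [chebyshev]
        | one => simp [chebyshev]
        | more m h1 h2 => rw [chebyshev, h2]; ring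
      rw [kerEntry_low _ _ _ le_rfl, this]
      simp [hz]
    · refine ⟨0, by omega, ?_⟩
      rw [kerEntry_low _ _ _ (Nat.zero_le _)]
      simp [chebyshev, hy]
  · refine ⟨2 * c - 0, by omega, ?_⟩
    rw [kerEntry_high _ _ _ (Nat.zero_le _)]
    simp [chebyshev, hx]

theorem kerMat_mulVec (c : ℕ) (x y z : R) (a : Fin 2 → R) (i : Fin (2 * c + 2)) :
    (kerMat c x y z).mulVec a i =
      (if (i : ℕ) = 2 * c + 1 then 1 else 0) * a 0 + kerEntry c x y z i * a 1 := by
  simp [Matrix.mulVec, dotProduct, kerMat, Fin.sum_univ_two]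

theorem injective_kerMat (c : ℕ) {x y z : ℂ} (hxyz : x ≠ 0 ∨ y ≠ 0 ∨ z ≠ 0) :
    Function.Injective (kerMat c x y z).mulVecLin := by
  rw [← LinearMap.ker_eq_bot, LinearMap.ker_eq_bot']
  intro a ha
  obtain ⟨p, hp, hne⟩ := exists_kerEntry_ne_zero c hxyz
  have h1 := congrFun ha ⟨p, by omega⟩
  rw [Matrix.mulVecLin_apply, kerMat_mulVec, if_neg (by simp; omega)] at h1
  have ha1 : a 1 = 0 := by simpa [hne] using h1
  have h0 := congrFun ha (Fin.last _)
  rw [Matrix.mulVecLin_apply, kerMat_mulVec,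
    if_pos (show (Fin.last (2 * c + 1) : ℕ) = 2 * c + 1 from rfl), ha1] at h0
  ext j
  fin_cases j
  · simpa using h0
  · exact ha1

theorem rank_splitMat {c : ℕ} (hc : 0 < c) {x y z : ℂ} (hxyz : x ≠ 0 ∨ y ≠ 0 ∨ z ≠ 0) :
    (splitMat c x y z).rank = 2 * c ∧
      LinearMap.ker (splitMat c x y z).mulVecLin = LinearMap.range (kerMat c x y z).mulVecLin := by
  have hle : LinearMap.range (kerMat c x y z).mulVecLin ≤
      LinearMap.ker (splitMat c x y z).mulVecLin := by
    rw [LinearMap.range_le_ker_iff, ← Matrix.mulVecLin_mul, splitMat_mul_kerMat hc]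
    exact Matrix.mulVecLin_zero
  have h2 : Module.finrank ℂ (LinearMap.range (kerMat c x y z).mulVecLin) = 2 := by
    rw [LinearMap.finrank_range_of_inj (injective_kerMat c hxyz)]
    simp
  have h3 : Module.finrank ℂ (LinearMap.ker (splitMat c x y z).mulVecLin) ≤ 2 := by
    obtain ⟨p, hp⟩ := exists_coordinate_of_mulVec_splitMat c hxyz
    let g : (Fin (2 * c + 2) → ℂ) →ₗ[ℂ] (Fin 2 → ℂ) :=
      LinearMap.pi ![LinearMap.proj p, LinearMap.proj (Fin.last _)]
    have hg : Function.Injective (g.domRestrict (LinearMap.ker (splitMat c x y z).mulVecLin)) := by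
      rw [← LinearMap.ker_eq_bot, LinearMap.ker_eq_bot']
      rintro ⟨u, hu⟩ h0
      ext1
      exact hp u hu (congrFun h0 0) (congrFun h0 1)
    simpa using LinearMap.finrank_le_finrank_of_injective hg
  have h4 := LinearMap.finrank_range_add_finrank_ker (splitMat c x y z).mulVecLin
  rw [Module.finrank_fintype_fun_eq_card, Fintype.card_fin] at h4
  have h5 := Submodule.finrank_mono hle
  refine ⟨?_, (Submodule.eq_of_le_of_finrank_le hle (by omega)).symm⟩
  rw [Matrix.rank]
  omega

theorem surjective_kerMat_transpose (c : ℕ) {x y z : ℂ} (hxyz : x ≠ 0 ∨ y ≠ 0 ∨ z ≠ 0) :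
    Function.Surjective (kerMat c x y z).transpose.mulVecLin := by
  rw [← LinearMap.range_eq_top]
  apply Submodule.eq_top_of_finrank_eq
  change (kerMat c x y z).transpose.rank = _
  rw [Matrix.rank_transpose, Matrix.rank, LinearMap.finrank_range_of_inj (injective_kerMat c hxyz)]

/-- Transposing the kernel relation gives one inclusion by skew-symmetry, and ranks give equality.
So the transposed kernel matrix is the projection onto the cokernel. -/
theorem range_splitMat {c : ℕ} (hc : 0 < c) {x y z : ℂ} (hxyz : x ≠ 0 ∨ y ≠ 0 ∨ z ≠ 0) :
    LinearMap.range (splitMat c x y z).mulVecLin =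
      LinearMap.ker (kerMat c x y z).transpose.mulVecLin := by
  refine Submodule.eq_of_le_of_finrank_eq ?_ ?_
  · rw [LinearMap.range_le_ker_iff, ← Matrix.mulVecLin_mul]
    have : (kerMat c x y z).transpose * splitMat c x y z = 0 := by
      rw [← Matrix.transpose_inj, Matrix.transpose_mul, Matrix.transpose_transpose,
        splitMat_transpose, Matrix.neg_mul, splitMat_mul_kerMat hc]
      simp
    rw [this]
    exact Matrix.mulVecLin_zero
  · have h1 := (rank_splitMat hc hxyz).1
    rw [Matrix.rank] at h1
    have h2 := LinearMap.finrank_range_add_finrank_ker (kerMat c x y z).transpose.mulVecLin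
    rw [LinearMap.range_eq_top.2 (surjective_kerMat_transpose c hxyz), finrank_top,
      Module.finrank_fintype_fun_eq_card, Module.finrank_fintype_fun_eq_card] at h2
    simp only [Fintype.card_fin] at h2
    omega

end Split

/-! ### The matrix with cokernel 𝒪 ⊕ 𝒪(c), as a map of bundles -/

section SplitBundles

/-- The matrix `splitMat` in the coordinates of the plane. -/
noncomputable abbrev splitPencil (c : ℕ) : Matrix (Fin (2 * c + 2)) (Fin (2 * c + 2)) Coord :=
  splitMat c (X 0) (X 1) (X 2)

theorem coord_ne_zero {v : Fin 3 → ℂ} (hv : v ≠ 0) : v 0 ≠ 0 ∨ v 1 ≠ 0 ∨ v 2 ≠ 0 := by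
  by_contra! h
  apply hv
  ext i
  fin_cases i
  exacts [h.1, h.2.1, h.2.2]

theorem splitPencil_map (c : ℕ) (v : Fin 3 → ℂ) :
    (splitPencil c).map (eval v) = splitMat c (v 0) (v 1) (v 2) := by
  rw [splitPencil, splitMat_map, eval_X, eval_X, eval_X]

theorem splitPencil_linear (c : ℕ) (i j : Fin (2 * c + 2)) :
    (splitPencil c i j).IsHomogeneous 1 := by
  have hs : ∀ a : ℤ, ∀ p : Coord, p.IsHomogeneous 1 → ((a : Coord) * p).IsHomogeneous 1 := by
    intro a p hp
    have := hp.C_mul (a : ℂ)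
    simpa using this
  simp only [splitMat, splitEntry, Matrix.of_apply]
  split_ifs
  · exact hs _ _ (isHomogeneous_X _ _)
  · exact hs _ _ (isHomogeneous_X _ _)
  · exact hs _ _ (isHomogeneous_X _ _)
  · exact hs _ _ (isHomogeneous_zero _ _ _)
  · exact isHomogeneous_zero _ _ _

theorem isHomogeneous_chebyshev (m : ℕ) :
    (chebyshev (X 0) (X 1) (X 2) m : Coord).IsHomogeneous m := by
  induction m using Nat.twoStepInduction with
  | zero => exact isHomogeneous_one _ _
  | one => exact isHomogeneous_X _ _
  | more m h1 h2 =>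
    rw [chebyshev]
    refine IsHomogeneous.sub ?_ ?_
    · have := (isHomogeneous_X ℂ (2 : Fin 3)).mul h2
      rwa [show 1 + (m + 1) = m + 2 by ring] at this
    · have := ((isHomogeneous_X ℂ (0 : Fin 3)).mul (isHomogeneous_X ℂ (1 : Fin 3))).mul h1
      rwa [show 1 + 1 + m = m + 2 by ring] at this

theorem isHomogeneous_kerEntry (c k : ℕ) :
    (kerEntry c (X 0) (X 1) (X 2) k : Coord).IsHomogeneous c := by
  have key : ∀ (a : ℕ) (i : Fin 3) (b m : ℕ), b + m = c →
      ((-1) ^ a * X i ^ b * chebyshev (X 0) (X 1) (X 2) m : Coord).IsHomogeneous c := by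
    intro a i b m hbm
    have h1 := ((isHomogeneous_X_pow (R := ℂ) i b).C_mul ((-1) ^ a)).mul (isHomogeneous_chebyshev m)
    rw [hbm] at h1
    simpa using h1
  unfold kerEntry
  split_ifs
  · exact key _ _ _ _ (by omega)
  · exact key _ _ _ _ (by omega)
  · exact isHomogeneous_zero _ _ _

theorem isForm_kerMat (c : ℕ) (i : Fin (2 * c + 2)) (j : Fin 2) :
    IsForm (kerMat c (X 0) (X 1) (X 2) i j) (![0, (c : ℤ)] j) := by
  fin_cases j
  · refine isForm_of_isHomogeneous (k := 0) ?_ rfl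
    simp only [kerMat, Matrix.of_apply]
    change (if (i : ℕ) = 2 * c + 1 then (1 : Coord) else 0).IsHomogeneous 0
    split_ifs
    · exact isHomogeneous_one _ _
    · exact isHomogeneous_zero _ _ _
  · exact isForm_of_isHomogeneous (isHomogeneous_kerEntry c i) rfl

/-- The inclusion of the kernel of the matrix `splitPencil`. -/
noncomputable def splitKerHom (c : ℕ) : SplitBundle.Hom ⟨2, ![-1, -1 - (c : ℤ)]⟩
    (copies (2 * c + 2) (-1)) where
  mat := kerMat c (X 0) (X 1) (X 2)
  isForm i j := by
    convert isForm_kerMat c i j using 1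
    fin_cases j <;> simp

/-- The projection onto the cokernel of the matrix `splitPencil`. -/
noncomputable def splitCokerHom (c : ℕ) : SplitBundle.Hom (copies (2 * c + 2) 0)
    ⟨2, ![0, (c : ℤ)]⟩ where
  mat := (kerMat c (X 0) (X 1) (X 2)).transpose
  isForm i j := by
    have h := isForm_kerMat c j i
    rw [← sub_zero ((![0, (c : ℤ)] : Fin 2 → ℤ) i)] at h
    exact h

theorem splitKerHom_fibre (c : ℕ) (v : Fin 3 → ℂ) :
    (splitKerHom c).fibre v = (kerMat c (v 0) (v 1) (v 2)).mulVecLin := by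
  have h : (kerMat c (X 0) (X 1) (X 2)).map (eval v) = kerMat c (v 0) (v 1) (v 2) := by
    rw [kerMat_map, eval_X, eval_X, eval_X]
  rw [← h]; rfl

theorem splitCokerHom_fibre (c : ℕ) (v : Fin 3 → ℂ) :
    (splitCokerHom c).fibre v = (kerMat c (v 0) (v 1) (v 2)).transpose.mulVecLin := by
  have h : (kerMat c (X 0) (X 1) (X 2)).map (eval v) = kerMat c (v 0) (v 1) (v 2) := by
    rw [kerMat_map, eval_X, eval_X, eval_X]
  rw [← h]; rfl

theorem isSkewConstantRank_splitPencil {c : ℕ} (hc : 0 < c) :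
    IsSkewConstantRank c (splitPencil c) :=
  isSkewConstantRank_of_rank hc (splitPencil_linear c) (splitMat_transpose c _ _ _) fun v hv => by
    rw [splitPencil_map]
    exact (rank_splitMat hc (coord_ne_zero hv)).1

theorem cokerIso_splitPencil {c : ℕ} (hc : 0 < c)
    (hA : ∀ i j, (splitPencil c i j).IsHomogeneous 1) :
    CokerIso (linearHom (splitPencil c) hA) (SplitBundle.fromZero ⟨2, ![0, (c : ℤ)]⟩) := by
  refine cokerIso_of_range_eq_comap (splitCokerHom c) (fun v hv => ?_) fun v hv => ?_
  · rw [splitCokerHom_fibre]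
    exact surjective_kerMat_transpose c (coord_ne_zero hv)
  · have h0 : LinearMap.range ((SplitBundle.fromZero ⟨2, ![0, (c : ℤ)]⟩).fibre v) = ⊥ := by
      rw [LinearMap.range_eq_bot]
      refine LinearMap.ext fun x => ?_
      rw [show x = 0 from _root_.funext fun j => Fin.elim0 j, map_zero, map_zero]
    rw [h0, Submodule.comap_bot, linearHom_fibre, splitPencil_map, splitCokerHom_fibre]
    exact range_splitMat hc (coord_ne_zero hv)

/-- The identity morphism of a trivial bundle. -/
noncomputable def idHom (n : ℕ) : (copies n 0).Hom (copies n 0) where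
  mat := (1 : Matrix (Fin n) (Fin n) Coord)
  isForm i j := isForm_of_isHomogeneous (k := 0) (by
    rw [Matrix.one_apply]
    split_ifs
    · exact isHomogeneous_one _ _
    · exact isHomogeneous_zero _ _ _) (by simp)

theorem idHom_fibre (n : ℕ) (v : Fin 3 → ℂ) (x : Fin n → ℂ) : (idHom n).fibre v x = x := by
  have h : (1 : Matrix (Fin n) (Fin n) Coord).map (eval v) = 1 := by
    rw [Matrix.map_one _ (map_zero _) (map_one _)]
  change ((1 : Matrix (Fin n) (Fin n) Coord).map (eval v)).mulVec x = x
  rw [h, Matrix.one_mulVec]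

theorem hasChernClasses_splitPencil {c : ℕ} (hc : 0 < c)
    (hA : ∀ i j, (splitPencil c i j).IsHomogeneous 1) :
    HasChernClasses (linearHom (splitPencil c) hA) c 0 := by
  refine hasChernClasses_of_threeTerm (linearHom (splitPencil c) hA) (splitKerHom c)
    (idHom _) (fun v hv => ?_) (fun v hv => ?_) (fun v hv x => ?_) (fun v hv y => ?_) ?_ ?_
  · rw [splitKerHom_fibre]
    exact injective_kerMat c (coord_ne_zero hv)
  · rw [LinearMap.exact_iff, splitKerHom_fibre, linearHom_fibre, splitPencil_map]
    exact (rank_splitMat hc (coord_ne_zero hv)).2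
  · rw [LinearMap.comp_apply, Submodule.mkQ_apply, Submodule.Quotient.mk_eq_zero, idHom_fibre]
    exact Iff.rfl
  · obtain ⟨y, rfl⟩ := Submodule.mkQ_surjective _ y
    refine ⟨y, ?_⟩
    rw [LinearMap.comp_apply, idHom_fibre]
  · rw [powerSum_copies, powerSum_copies, SplitBundle.powerSum, Fin.sum_univ_two]
    simp
    ring
  · rw [powerSum_copies, powerSum_copies, SplitBundle.powerSum, Fin.sum_univ_two]
    simp
    ring

end SplitBundles

end PlaneBundle

theorem mainTheorem3 :
    (∀ (c : ℕ) (y : ℤ), PlaneBundle.MEffective c y →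
      0 < c ∧ 0 ≤ y ∧ y ≤ ((c + 1).choose 2 : ℤ)) ∧
    (∀ c : ℕ, 0 < c →
      PlaneBundle.MEffective c 0 ∧ PlaneBundle.MEffective c ((c + 1).choose 2 : ℤ)) ∧
    (∀ c : ℕ, 0 < c →
      ∃ (A : Matrix (Fin (2 * c + 2)) (Fin (2 * c + 2)) PlaneBundle.Coord)
        (hA : PlaneBundle.IsSkewConstantRank c A),
        PlaneBundle.CokerIso (PlaneBundle.linearHom A hA.linear)
          (PlaneBundle.SplitBundle.fromZero ⟨2, ![0, (c : ℤ)]⟩) ∧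
        PlaneBundle.HasChernClasses (PlaneBundle.linearHom A hA.linear) c 0) ∧
    (∀ c : ℕ, 0 < c →
      (∃ B : Matrix (Fin (c + 2)) (Fin c) PlaneBundle.Coord, PlaneBundle.IsSteiner c B) ∧
      ∀ (B : Matrix (Fin (c + 2)) (Fin c) PlaneBundle.Coord) (hB : PlaneBundle.IsSteiner c B),
        ∃ (A : Matrix (Fin (2 * c + 2)) (Fin (2 * c + 2)) PlaneBundle.Coord)
          (hA : PlaneBundle.IsSkewConstantRank c A),
          PlaneBundle.CokerIso (PlaneBundle.linearHom A hA.linear)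
            (PlaneBundle.linearHom B hB.linear) ∧
          PlaneBundle.HasChernClasses (PlaneBundle.linearHom A hA.linear) c
            ((c + 1).choose 2 : ℤ)) := by
  refine ⟨fun c y h => h.bounds, fun c hc => ⟨?_, ?_⟩, fun c hc => ?_, fun c hc => ⟨?_, ?_⟩⟩
  · exact ⟨_, PlaneBundle.isSkewConstantRank_splitPencil hc,
      PlaneBundle.hasChernClasses_splitPencil hc _⟩
  · exact ⟨_, (PlaneBundle.isSteiner_banded c).isSkewConstantRank hc,
      (PlaneBundle.isSteiner_banded c).hasChernClasses _⟩
  · exact ⟨_, PlaneBundle.isSkewConstantRank_splitPencil hc,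
      PlaneBundle.cokerIso_splitPencil hc _, PlaneBundle.hasChernClasses_splitPencil hc _⟩
  · exact ⟨_, PlaneBundle.isSteiner_banded c⟩
  · exact fun B hB => ⟨_, hB.isSkewConstantRank hc, hB.cokerIso _, hB.hasChernClasses _⟩
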